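/- All graphs are finite and simple. A graph is $d$-degenerate if each of its nonempty subgraphs has a vertex of degree at most $d$ (in that subgraph). The density of a graph is the fraction of the unordered pairs of distinct vertices that form an edge. **Theorem.** There exists a constant $c > 0$ such that the following holds for every natural number $d$ and every real number $\alpha$ with $0 < \alpha \le \frac12$. For every natural number $n \ge \alpha^{-cd^2}$, if $G$ is a graph with at least $\alpha^{-cd} n$ vertices and density at least $\alpha$, then $G$ contains every $d$-degenerate bipartite graph on $n$ vertices as a (not necessarily induced) subgraph. -/

import Mathlib

namespace SimpleGraph

/-- A graph is `d`-degenerate if each of its (nonempty, not necessarily induced) subgraphs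
contains a vertex whose degree in that subgraph is at most `d`. -/
def IsDegenerate {W : Type*} (H : SimpleGraph W) (d : ℕ) : Prop :=
  ∀ K : H.Subgraph, K.verts.Nonempty →
    ∃ v ∈ K.verts, (K.neighborSet v).encard ≤ (d : ℕ∞)

/-- The density of a finite graph: the fraction of the (unordered) pairs of distinct vertices
that form an edge. -/
noncomputable def density {V : Type*} (G : SimpleGraph V) : ℝ :=
  (G.edgeSet.ncard : ℝ) / ((Nat.card V).choose 2 : ℝ)

/-- `G` is universal for the family of `d`-degenerate bipartite graphs on `n` vertices: it contains
each of them as a (not necessarily induced) subgraph. -/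
def IsUniversalForDegenerateBipartite {V : Type*} (G : SimpleGraph V) (d n : ℕ) : Prop :=
  ∀ H : SimpleGraph (Fin n), H.IsDegenerate d → H.IsBipartite → H.IsContained G

end SimpleGraph

/-!
The graph `H` is embedded by a random greedy procedure into two sets `A` and `B` of vertices of `G`,
one for each color class, along an order in which every vertex has at most `d` earlier neighbors.

* The sets come from a two-sided dependent random choice (`SimpleGraph.exists_rich_pair`): `A` is the
  common neighborhood of a random `s`-tuple `T`, and `B` that of a random `s`-tuple from `A`, with
  `s = 16 d`. A tuple `Q` survives in `A` with probability `(#N(Q) / #V) ^ s`, so the `s`-th negative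
  moment of the number of common neighbors is controlled over all tuples of at most `d` vertices,
  on the absolute scale `θ = α ^ (96 d) * #V`. Moreover every tuple has some common neighbor,
  because all of `A` is adjacent to the entries of `T`.

* In the random process (`RandomGreedy.exists_outcome`) a vertex whose earlier neighbors have about
  `θ / 2 ^ j` common neighbors has level `j`. The image of an earlier vertex of level `i` is
  distributed like a uniform vertex up to a factor `4 ^ i * 16 / θ * #V`. Damping by these factors
  compares the `≤ d` images with an independent tuple (`RandomGreedy.expect_tuple_le`), and the
  inequality of the arithmetic and geometric means removes the damping at the cost of the moments of
  the earlier levels, which are controlled inductively. Hence in expectation, and so in some outcome,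
  at most `n / 2 ^ (8 d j)` vertices have level `j ≥ 1`.

* Vertices of different levels must not compete for the few common neighbors of the bad tuples.
  A random labelling of the vertices of `G` (`exists_geometric_labelling`) reserves for the level `j`
  a proportion of about `2 ^ (-j - 1)` of `V` and, by a Chernoff bound, a comparable proportion of
  every relevant common neighborhood. For all levels that occur, the reserved part of a common
  neighborhood has size at least `θ / (8 * 4 ^ j)`, which is at least twice the number of vertices of
  level `j`, so that a new image can be chosen
  (`SimpleGraph.exists_embedding_of_rich`). The hypothesis `n ≥ α ^ (-c d ^ 2)` makes the relevant
  common neighborhoods large enough for the union bound over all tuples.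
-/

/-! ### The random greedy process and its moments -/

namespace RandomGreedy

/-- The average of `Φ` over all ways of redefining `f` at `m` by an element of `C m f`. -/
noncomputable def step {V : Type*} (C : ℕ → (ℕ → V) → Finset V) (m : ℕ)
    (Φ : (ℕ → V) → ℝ) (f : ℕ → V) : ℝ :=
  (∑ y ∈ C m f, Φ (Function.update f m y)) / ((C m f).card : ℝ)

/-- `expect C m Φ f` is the expectation of `Φ` after the values of `f` at `0, …, m - 1` have been
replaced, in this order, by uniformly random elements of the current candidate sets
`C 0 f, …, C (m - 1) f`. -/
noncomputable def expect {V : Type*} (C : ℕ → (ℕ → V) → Finset V) :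
    ℕ → ((ℕ → V) → ℝ) → (ℕ → V) → ℝ
  | 0, Φ => Φ
  | m + 1, Φ => expect C m (step C m Φ)

section expect

variable {V : Type*} {C : ℕ → (ℕ → V) → Finset V}

theorem step_mono {m : ℕ} {Φ Ψ : (ℕ → V) → ℝ} (h : ∀ f, Φ f ≤ Ψ f) (f : ℕ → V) :
    step C m Φ f ≤ step C m Ψ f := by
  unfold step
  gcongr
  exact h _

theorem expect_mono {m : ℕ} : ∀ {Φ Ψ : (ℕ → V) → ℝ}, (∀ f, Φ f ≤ Ψ f) → ∀ f,
    expect C m Φ f ≤ expect C m Ψ f := by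
  induction m with
  | zero => intro Φ Ψ h f; exact h f
  | succ m ih => intro Φ Ψ h f; exact ih (step_mono h) f

theorem expect_add {m : ℕ} : ∀ (Φ Ψ : (ℕ → V) → ℝ),
    expect C m (fun f => Φ f + Ψ f) = fun f => expect C m Φ f + expect C m Ψ f := by
  induction m with
  | zero => intro Φ Ψ; rfl
  | succ m ih =>
    intro Φ Ψ
    have : step C m (fun f => Φ f + Ψ f) = fun f => step C m Φ f + step C m Ψ f := by
      funext f
      simp only [step, Finset.sum_add_distrib, add_div]
    simp only [expect, this, ih]

theorem expect_const_mul {m : ℕ} (c : ℝ) : ∀ (Φ : (ℕ → V) → ℝ),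
    expect C m (fun f => c * Φ f) = fun f => c * expect C m Φ f := by
  induction m with
  | zero => intro Φ; rfl
  | succ m ih =>
    intro Φ
    have : step C m (fun f => c * Φ f) = fun f => c * step C m Φ f := by
      funext f
      simp only [step, ← Finset.mul_sum, mul_div_assoc]
    simp only [expect, this, ih]

theorem step_eq_self (hC : ∀ m f, (C m f).Nonempty) {m : ℕ} {Φ : (ℕ → V) → ℝ}
    (hΦ : DependsOn Φ (Set.Iio m)) : step C m Φ = Φ := by
  funext f
  have h : ∀ y, Φ (Function.update f m y) = Φ f := fun y => hΦ fun i hi =>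
    Function.update_of_ne (ne_of_lt hi) _ _
  have h0 : ((C m f).card : ℝ) ≠ 0 := by exact_mod_cast (hC m f).card_pos.ne'
  simp only [step, h, Finset.sum_const, nsmul_eq_mul]
  field_simp

theorem expect_const (hC : ∀ m f, (C m f).Nonempty) (m : ℕ) (c : ℝ) :
    expect C m (fun _ => c) = fun _ => c := by
  induction m with
  | zero => rfl
  | succ m ih =>
    rw [expect, step_eq_self hC (fun _ _ _ => rfl), ih]

theorem expect_finsetSum (hC : ∀ m f, (C m f).Nonempty) (m : ℕ) {ι : Type*} (s : Finset ι)
    (Φ : ι → (ℕ → V) → ℝ) (f : ℕ → V) :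
    expect C m (fun f => ∑ i ∈ s, Φ i f) f = ∑ i ∈ s, expect C m (Φ i) f := by
  classical
  induction s using Finset.induction_on with
  | empty => simp [expect_const hC]
  | insert a s ha ih => simp only [Finset.sum_insert ha, expect_add, ih]

/-- Some outcome of the random process does not exceed the expectation. -/
theorem exists_le_of_expect_le (hC : ∀ m f, (C m f).Nonempty)
    (hCd : ∀ m, DependsOn (C m) (Set.Iio m)) {m : ℕ} {c : ℝ} : ∀ {Φ : (ℕ → V) → ℝ} {f : ℕ → V},
    expect C m Φ f ≤ c → ∃ g, (∀ w < m, g w ∈ C w g) ∧ Φ g ≤ c := by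
  induction m with
  | zero => intro Φ f h; exact ⟨f, by simp, h⟩
  | succ m ih =>
    intro Φ f h
    obtain ⟨g, hg, hle⟩ := ih h
    obtain ⟨y, hy, hyc⟩ : ∃ y ∈ C m g, Φ (Function.update g m y) ≤ c := by
      have h0 : (0 : ℝ) < (C m g).card := by exact_mod_cast (hC m g).card_pos
      apply Finset.exists_le_of_sum_le (hC m g)
      rw [step, div_le_iff₀ h0] at hle
      simpa [mul_comm] using hle
    refine ⟨Function.update g m y, fun w hw => ?_, hyc⟩
    have hCw : C w (Function.update g m y) = C w g := hCd w fun i hi =>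
      Function.update_of_ne (ne_of_lt (lt_of_lt_of_le hi (Nat.lt_succ_iff.1 hw))) _ _
    rw [hCw]
    rcases (Nat.lt_succ_iff.1 hw).lt_or_eq with hlt | rfl
    · rw [Function.update_of_ne hlt.ne]
      exact hg w hlt
    · simpa using hy

/-- Comparison of the random process with independent uniform choices: if the damping factor
`κ u` compensates for the size of the candidate set at time `u`, then the damped expectation of a
function of the values at the times `e 0 < e 1 < ⋯` is bounded by its sum over all tuples. -/
theorem expect_tuple_le [Fintype V] (hC : ∀ m f, (C m f).Nonempty)
    {κ : ℕ → (ℕ → V) → ℝ} (hκ0 : ∀ u f, 0 ≤ κ u f) (hκd : ∀ u, DependsOn (κ u) (Set.Iio u))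
    {ρ : ℝ} (hρ : 0 ≤ ρ) (hκ : ∀ u f, κ u f / ((C u f).card : ℝ) ≤ ρ) (m : ℕ) :
    ∀ {k : ℕ} (e : Fin k → ℕ), StrictMono e → (∀ i, e i < m) → ∀ (h : (Fin k → V) → ℝ),
      (∀ Q, 0 ≤ h Q) → ∀ f,
      expect C m (fun f => h (f ∘ e) * ∏ i, κ (e i) f) f ≤ ρ ^ k * ∑ Q, h Q := by
  induction m with
  | zero =>
    intro k e he hm h h0 f
    obtain rfl : k = 0 := by
      by_contra hk
      exact absurd (hm ⟨0, Nat.pos_of_ne_zero hk⟩) (by simp)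
    simp only [expect, Finset.univ_eq_empty, Finset.prod_empty, mul_one, pow_zero, one_mul]
    exact Finset.single_le_sum (f := h) (fun Q _ => h0 Q) (Finset.mem_univ _)
  | succ m ih =>
    intro k e he hm h h0 f
    by_cases hlast : ∀ i, e i < m
    · rw [expect, step_eq_self hC]
      · exact ih e he hlast h h0 f
      · intro x y hxy
        have h1 : x ∘ e = y ∘ e := funext fun i => hxy _ (hlast i)
        have h2 : ∀ i, κ (e i) x = κ (e i) y := fun i =>
          hκd _ fun j hj => hxy _ (lt_trans hj (hlast i))
        simp only [h1, h2]
    · push Not at hlast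
      obtain ⟨i0, hi0⟩ := hlast
      obtain ⟨k, rfl⟩ : ∃ k', k = k' + 1 := ⟨k - 1, by have := i0.2; omega⟩
      have hem : e (Fin.last k) = m := by
        have h1 := hm (Fin.last k)
        have h2 := he.monotone (Fin.le_last i0)
        omega
      have hem' : ∀ i : Fin k, e i.castSucc < m := fun i => by
        rw [← hem]; exact he (Fin.castSucc_lt_last i)
      have key : ∀ f, step C m (fun f => h (f ∘ e) * ∏ i, κ (e i) f) f ≤
          ρ * ((∑ y, h (Fin.snoc (f ∘ (e ∘ Fin.castSucc)) y)) *
            ∏ i, κ ((e ∘ Fin.castSucc) i) f) := by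
        intro f
        have h1 : ∀ y, Function.update f m y ∘ e =
            Fin.snoc (α := fun _ => V) (f ∘ (e ∘ Fin.castSucc)) y := by
          intro y
          funext i
          refine Fin.lastCases ?_ (fun i => ?_) i
          · simp [hem]
          · simp [(hem' i).ne]
        have h2 : ∀ y i, κ (e i) (Function.update f m y) = κ (e i) f := fun y i =>
          hκd _ fun j hj => Function.update_of_ne
            (ne_of_lt (lt_of_lt_of_le hj (Nat.lt_succ_iff.1 (hm i)))) _ _
        have hP : 0 ≤ ∏ i : Fin k, κ (e i.castSucc) f := Finset.prod_nonneg fun i _ => hκ0 _ _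
        simp only [step, h1, h2, Fin.prod_univ_castSucc, hem, ← Finset.sum_mul,
          Function.comp_apply]
        calc (∑ y ∈ C m f, h (Fin.snoc (f ∘ (e ∘ Fin.castSucc)) y)) *
              ((∏ i : Fin k, κ (e i.castSucc) f) * κ m f) / ((C m f).card : ℝ)
            = (κ m f / ((C m f).card : ℝ)) *
              ((∑ y ∈ C m f, h (Fin.snoc (f ∘ (e ∘ Fin.castSucc)) y)) *
              (∏ i : Fin k, κ (e i.castSucc) f)) := by ring
          _ ≤ ρ * ((∑ y, h (Fin.snoc (f ∘ (e ∘ Fin.castSucc)) y)) *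
              (∏ i : Fin k, κ (e i.castSucc) f)) := by
            gcongr
            · exact mul_nonneg (Finset.sum_nonneg fun _ _ => h0 _) hP
            · exact hκ m f
            · exact fun _ _ _ => h0 _
            · exact Finset.subset_univ _
      refine (expect_mono key f).trans ?_
      rw [expect_const_mul]
      have hstep := ih (e ∘ Fin.castSucc) (he.comp (Fin.strictMono_castSucc)) hem'
        (fun Q => ∑ y, h (Fin.snoc Q y)) (fun Q => Finset.sum_nonneg fun _ _ => h0 _) f
      have hsum : ∑ Q : Fin (k + 1) → V, h Q = ∑ Q : Fin k → V, ∑ y, h (Fin.snoc Q y) := by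
        rw [← (Fin.snocEquiv (fun _ : Fin (k + 1) => V)).sum_comp, Fintype.sum_prod_type,
          Finset.sum_comm]
        rfl
      rw [hsum, pow_succ', mul_assoc]
      exact mul_le_mul_of_nonneg_left hstep hρ

end expect

/-- A product of at most `d` numbers `4 ^ τ i` is at most `1` plus the sum of the `d`-th powers. -/
theorem prod_four_pow_le {k d : ℕ} (hk : k ≤ d) (τ : Fin k → ℕ) :
    ∏ i, (4 : ℝ) ^ τ i ≤ 1 + ∑ i, (4 : ℝ) ^ (d * τ i) := by
  rcases Nat.eq_zero_or_pos k with rfl | hk0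
  · simp
  have : Nonempty (Fin k) := ⟨⟨0, hk0⟩⟩
  obtain ⟨i0, hi0⟩ := Finite.exists_max τ
  calc ∏ i, (4 : ℝ) ^ τ i ≤ ∏ _i : Fin k, (4 : ℝ) ^ τ i0 := by
        gcongr with i
        · norm_num
        · exact hi0 i
    _ = (4 : ℝ) ^ (τ i0 * k) := by simp [pow_mul]
    _ ≤ (4 : ℝ) ^ (d * τ i0) := by
        apply pow_le_pow_right₀ (by norm_num)
        rw [mul_comm]; gcongr
    _ ≤ ∑ i, (4 : ℝ) ^ (d * τ i) :=
        Finset.single_le_sum (f := fun i => (4 : ℝ) ^ (d * τ i)) (fun i _ => by positivity)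
          (Finset.mem_univ i0)
    _ ≤ _ := by linarith

/-- The weight of a step of type `j`. Steps of type `0` are harmless and cost nothing. -/
noncomputable def weight (d j : ℕ) : ℝ := if j = 0 then 0 else 2 ^ (8 * d * j)

theorem weight_nonneg (d j : ℕ) : 0 ≤ weight d j := by
  unfold weight; split_ifs <;> positivity

theorem four_pow_le_one_add_weight (d j : ℕ) : (4 : ℝ) ^ (d * j) ≤ 1 + weight d j := by
  unfold weight
  split_ifs with h
  · simp [h]
  · have h1 : (4 : ℝ) ^ (d * j) = 2 ^ (2 * (d * j)) := by
      rw [pow_mul (2 : ℝ) 2]; norm_num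
    have h2 : (2 : ℝ) ^ (2 * (d * j)) ≤ 2 ^ (8 * d * j) :=
      pow_le_pow_right₀ (by norm_num) (by nlinarith [Nat.zero_le (d * j)])
    linarith

/-- **Random greedy choice.** The step `w` has a type `τ w` that depends on at most `d` earlier
values, and its candidate set has at least `ρ⁻¹ / 4 ^ τ` elements. If large types are rare
among all tuples of values, in the sense of a second moment of the weight, then in some outcome of
the process the weights add up to at most the number of steps. -/
theorem exists_outcome {V : Type*} [Fintype V] [Nonempty V] (n d : ℕ)
    {C : ℕ → (ℕ → V) → Finset V} (hC : ∀ m f, (C m f).Nonempty)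
    (hCd : ∀ m, DependsOn (C m) (Set.Iio m))
    (k : ℕ → ℕ) (hk : ∀ w, k w ≤ d) (e : ∀ w, Fin (k w) → ℕ) (he : ∀ w, StrictMono (e w))
    (hlt : ∀ w i, e w i < w) (τ : ∀ w, (Fin (k w) → V) → ℕ)
    {ρ : ℝ} (hρ0 : 0 ≤ ρ) (hρ : ∀ w f, 1 / ((C w f).card : ℝ) ≤ ρ * 4 ^ τ w (f ∘ e w))
    (hω : ∀ w, ρ ^ k w * ∑ Q, weight d (τ w Q) ^ 2 ≤ 1 / (1 + 2 * d)) :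
    ∃ f, (∀ w < n, f w ∈ C w f) ∧ ∑ w ∈ Finset.range n, weight d (τ w (f ∘ e w)) ≤ n := by
  obtain ⟨v0⟩ := ‹Nonempty V›
  set f0 : ℕ → V := fun _ => v0
  set κ : ℕ → (ℕ → V) → ℝ := fun u f => (1 / 4) ^ τ u (f ∘ e u) with hκ
  have hκpos : ∀ u f, 0 < κ u f := fun u f => by positivity
  have hd : (0 : ℝ) < 1 + 2 * d := by positivity
  have main : ∀ w, w < n → expect C n (fun f => weight d (τ w (f ∘ e w))) f0 ≤ 1 := by
    intro w
    induction w using Nat.strong_induction_on with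
    | _ w ih =>
    intro hw
    -- `x ≤ (x² Π / η + η / Π) / 2` with `η = 1 / (1 + 2 d)` and `Π` the product of the damping
    -- factors of the steps on which the type of step `w` depends
    have point : ∀ f : ℕ → V, weight d (τ w (f ∘ e w)) ≤
        ((1 + 2 * d) / 2) * (weight d (τ w (f ∘ e w)) ^ 2 * ∏ i, κ (e w i) f) +
        (1 / (2 * (1 + 2 * d))) * (1 + ∑ i, (1 + weight d (τ (e w i) (f ∘ e (e w i))))) := by
      intro f
      set x := weight d (τ w (f ∘ e w))
      set P := ∏ i, κ (e w i) f with hP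
      have hPpos : 0 < P := Finset.prod_pos fun i _ => hκpos _ _
      have hinv : 1 / P ≤ 1 + ∑ i, (1 + weight d (τ (e w i) (f ∘ e (e w i)))) := by
        have h1 : 1 / P = ∏ i, (4 : ℝ) ^ τ (e w i) (f ∘ e (e w i)) := by
          rw [hP, hκ, one_div, ← Finset.prod_inv_distrib]
          refine Finset.prod_congr rfl fun i _ => ?_
          simp
        rw [h1]
        refine (prod_four_pow_le (hk w) _).trans ?_
        gcongr with i
        exact four_pow_le_one_add_weight _ _
      have amgm : x ≤ ((1 + 2 * d) / 2) * (x ^ 2 * P) + (1 / (2 * (1 + 2 * d))) * (1 / P) := by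
        have : ((1 + 2 * d) / 2) * (x ^ 2 * P) + (1 / (2 * (1 + 2 * d))) * (1 / P) - x =
            (x * (1 + 2 * d) * P - 1) ^ 2 / (2 * (1 + 2 * d) * P) := by
          field_simp
          ring
        have h2 : 0 ≤ (x * (1 + 2 * d) * P - 1) ^ 2 / (2 * (1 + 2 * d) * P) := by positivity
        linarith
      refine amgm.trans ?_
      gcongr
    refine (expect_mono point f0).trans ?_
    rw [expect_add, expect_const_mul, expect_const_mul, expect_add, expect_const hC]
    have h1 : expect C n (fun f => weight d (τ w (f ∘ e w)) ^ 2 * ∏ i, κ (e w i) f) f0 ≤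
        1 / (1 + 2 * d) := by
      refine le_trans (expect_tuple_le hC (fun u f => (hκpos u f).le) ?_ hρ0 ?_ n (e w) (he w)
        (fun i => (hlt w i).trans hw) (fun Q => weight d (τ w Q) ^ 2) (fun Q => by positivity) f0)
        (hω w)
      · intro u x y hxy
        have : x ∘ e u = y ∘ e u := funext fun i => hxy _ (hlt u i)
        simp only [hκ, this]
      · intro u f
        have := hρ u f
        calc κ u f / ((C u f).card : ℝ) = κ u f * (1 / ((C u f).card : ℝ)) := by ring
          _ ≤ κ u f * (ρ * 4 ^ τ u (f ∘ e u)) := by gcongr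
          _ = ρ * ((1 / 4) * 4) ^ τ u (f ∘ e u) := by rw [mul_pow]; ring
          _ = ρ := by norm_num
    have h2 : expect C n (fun f => ∑ i, (1 + weight d (τ (e w i) (f ∘ e (e w i))))) f0 ≤
        2 * d := by
      rw [expect_finsetSum hC]
      calc ∑ i, expect C n (fun f => 1 + weight d (τ (e w i) (f ∘ e (e w i)))) f0
          ≤ ∑ _i : Fin (k w), (2 : ℝ) := by
            refine Finset.sum_le_sum fun i _ => ?_
            rw [expect_add, expect_const hC]
            have := ih (e w i) (hlt w i) ((hlt w i).trans hw)
            linarith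
        _ = 2 * k w := by simp [mul_comm]
        _ ≤ 2 * d := by
          have : (k w : ℝ) ≤ d := by exact_mod_cast hk w
          linarith
    calc _ ≤ ((1 + 2 * d) / 2) * (1 / (1 + 2 * d)) +
          (1 / (2 * (1 + 2 * d))) * (1 + 2 * (d : ℝ)) :=
        add_le_add (mul_le_mul_of_nonneg_left h1 (by positivity))
          (mul_le_mul_of_nonneg_left (add_le_add le_rfl h2) (by positivity))
      _ = 1 := by field_simp; norm_num
  refine exists_le_of_expect_le hC hCd (f := f0)
    (Φ := fun f => ∑ w ∈ Finset.range n, weight d (τ w (f ∘ e w))) ?_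
  rw [expect_finsetSum hC]
  calc _ ≤ ∑ w ∈ Finset.range n, (1 : ℝ) :=
        Finset.sum_le_sum fun w hw => main w (Finset.mem_range.1 hw)
    _ = n := by simp

end RandomGreedy

/-! ### Random labellings -/

/-- **Chernoff bound for a random labelling.** If every `i` prescribes a set `M i` of elements and
a label `l i`, and the expected numbers `p (l i) * #(M i)` are large, then for some
labelling every `M i` has at least a quarter of the expected number of elements labelled `l i`. -/
theorem exists_labelling {V L ι : Type*} [Fintype V] [DecidableEq V] [Fintype L] [DecidableEq L]
    [Fintype ι] (p : L → ℝ) (hp0 : ∀ l, 0 ≤ p l) (hp1 : ∑ l, p l = 1) (M : ι → Finset V)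
    (l : ι → L) (h : ∑ i, Real.exp (-(p (l i) * (M i).card / 4)) < 1) :
    ∃ g : V → L, ∀ i, p (l i) * (M i).card / 4 ≤ ((M i).filter (fun v => g v = l i)).card := by
  -- the exponential moment `q i g` exceeds `1` as soon as `M i` has too few elements
  set q : ι → (V → L) → ℝ := fun i g => Real.exp (p (l i) * (M i).card / 4) *
    ∏ v ∈ M i, (if g v = l i then (1 / 2 : ℝ) else 1) with hq
  have hple : ∀ l, p l ≤ 1 := fun l => hp1 ▸ Finset.single_le_sum (fun l _ => hp0 l)
    (Finset.mem_univ l)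
  have hmass : ∑ g : V → L, ∏ v, p (g v) = 1 := by
    rw [← Fintype.prod_sum]
    simp [hp1]
  have hmean : ∀ i, ∑ g : V → L, (∏ v, p (g v)) * q i g ≤
      Real.exp (-(p (l i) * (M i).card / 4)) := by
    intro i
    have h1 : ∀ g : V → L, (∏ v, p (g v)) * q i g = Real.exp (p (l i) * (M i).card / 4) *
        ∏ v, (p (g v) * if v ∈ M i then (if g v = l i then (1 / 2 : ℝ) else 1) else 1) := by
      intro g
      rw [Finset.prod_mul_distrib, Finset.prod_ite_mem, Finset.univ_inter, hq]
      ring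
    have h2 : ∀ v, ∑ x, (p x * if v ∈ M i then (if x = l i then (1 / 2 : ℝ) else 1) else 1) =
        if v ∈ M i then 1 - p (l i) / 2 else 1 := by
      intro v
      split_ifs with hv
      · have : ∀ x, p x * (if x = l i then (1 / 2 : ℝ) else 1) =
            p x - (if x = l i then p x / 2 else 0) := by
          intro x; split_ifs <;> ring
        simp only [this]
        rw [Finset.sum_sub_distrib, hp1]
        simp
      · simpa using hp1
    simp only [h1]
    rw [← Finset.mul_sum, ← Fintype.prod_sum
      (f := fun v x => p x * if v ∈ M i then (if x = l i then (1 / 2 : ℝ) else 1) else 1)]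
    simp only [h2]
    rw [Finset.prod_ite_mem, Finset.univ_inter, Finset.prod_const]
    have h3 : 1 - p (l i) / 2 ≤ Real.exp (-(p (l i) / 2)) := by
      have := Real.add_one_le_exp (-(p (l i) / 2)); linarith
    have h4 : 0 ≤ 1 - p (l i) / 2 := by have := hple (l i); linarith
    calc _ ≤ Real.exp (p (l i) * (M i).card / 4) * Real.exp (-(p (l i) / 2)) ^ (M i).card := by
          gcongr
      _ = _ := by
        rw [← Real.exp_nat_mul, ← Real.exp_add]
        congr 1
        ring
  by_contra! hcon
  have hbig : ∀ g : V → L, 1 ≤ ∑ i, q i g := by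
    intro g
    obtain ⟨i, hi⟩ := hcon g
    have hnn : ∀ i, 0 ≤ q i g := fun i => mul_nonneg (Real.exp_pos _).le
      (Finset.prod_nonneg fun v _ => by split_ifs <;> norm_num)
    refine le_trans ?_ (Finset.single_le_sum (f := fun i => q i g) (fun i _ => hnn i)
      (Finset.mem_univ i))
    set c := ((M i).filter (fun v => g v = l i)).card
    have h1 : ∏ v ∈ M i, (if g v = l i then (1 / 2 : ℝ) else 1) = (1 / 2) ^ c := by
      rw [Finset.prod_ite, Finset.prod_const, Finset.prod_const_one, mul_one]
    have h2 : Real.exp (-1) ≤ 1 / 2 := by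
      rw [Real.exp_neg, one_div]
      apply inv_anti₀ (by norm_num)
      have := Real.add_one_le_exp 1; linarith
    calc (1 : ℝ) ≤ Real.exp (p (l i) * (M i).card / 4 - c) := Real.one_le_exp (by linarith)
      _ = Real.exp (p (l i) * (M i).card / 4) * Real.exp (-1) ^ c := by
        rw [← Real.exp_nat_mul, ← Real.exp_add]; congr 1; ring
      _ ≤ Real.exp (p (l i) * (M i).card / 4) * (1 / 2) ^ c := by gcongr
      _ = q i g := by simp only [hq, h1]
  have : (1 : ℝ) ≤ ∑ i, Real.exp (-(p (l i) * (M i).card / 4)) :=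
    calc (1 : ℝ) = ∑ g : V → L, (∏ v, p (g v)) * 1 := by simp [hmass]
      _ ≤ ∑ g : V → L, (∏ v, p (g v)) * ∑ i, q i g := by
        gcongr with g
        · exact Finset.prod_nonneg fun v _ => hp0 _
        · exact hbig g
      _ = ∑ i, ∑ g : V → L, (∏ v, p (g v)) * q i g := by
        rw [Finset.sum_comm]; simp only [Finset.mul_sum]
      _ ≤ _ := Finset.sum_le_sum fun i _ => hmean i
  linarith

/-- A labelling with labels `0, …, J` in which every member of a family of sets of size at least
`m` has a `2 ^ (-j - 3)` proportion of its elements labelled `j`. -/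
theorem exists_geometric_labelling {V ι : Type*} [Fintype V] [DecidableEq V] [Fintype ι]
    (M : ι → Finset V) (J : ℕ) (m : ℝ)
    (h : (Fintype.card ι : ℝ) * (J + 1) < Real.exp (m / 2 ^ (J + 3))) :
    ∃ g : V → ℕ, ∀ i, m ≤ (M i).card → ∀ j ≤ J,
      ((M i).card : ℝ) / 2 ^ (j + 3) ≤ ((M i).filter (fun v => g v = j)).card := by
  set Z : ℝ := ∑ j : Fin (J + 1), (1 / 2 : ℝ) ^ (j.1 + 1) with hZ
  have hZpos : 0 < Z := Finset.sum_pos (fun j _ => by positivity) Finset.univ_nonempty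
  have hZle : Z ≤ 1 := by
    have := Finset.sum_range (n := J + 1) (fun j => (1 / 2 : ℝ) ^ (j + 1))
    rw [hZ, ← this]
    have h2 : ∀ K : ℕ, ∑ j ∈ Finset.range K, (1 / 2 : ℝ) ^ (j + 1) = 1 - (1 / 2) ^ K := by
      intro K
      induction K with
      | zero => simp
      | succ K ih => rw [Finset.sum_range_succ, ih]; ring
    rw [h2]
    have : (0 : ℝ) < (1 / 2) ^ (J + 1) := by positivity
    linarith
  have hp : ∀ j : Fin (J + 1), (1 / 2 : ℝ) ^ (j.1 + 1) ≤ (1 / 2 : ℝ) ^ (j.1 + 1) / Z := fun j => by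
    rw [le_div_iff₀ hZpos]
    exact mul_le_of_le_one_right (by positivity) hZle
  obtain ⟨g, hg⟩ := exists_labelling (V := V) (ι := {i : ι // m ≤ (M i).card} × Fin (J + 1))
    (fun j : Fin (J + 1) => (1 / 2 : ℝ) ^ (j.1 + 1) / Z) (fun j => by positivity)
    (by rw [← Finset.sum_div, div_self hZpos.ne']) (fun i => M i.1) (fun i => i.2) (by
      have hterm : ∀ i : {i : ι // m ≤ (M i).card} × Fin (J + 1),
          Real.exp (-((1 / 2 : ℝ) ^ (i.2.1 + 1) / Z * (M i.1).card / 4)) ≤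
          Real.exp (-(m / 2 ^ (J + 3))) := by
        intro i
        apply Real.exp_le_exp.2
        apply neg_le_neg
        have h1 : (1 / 2 : ℝ) ^ (J + 1) ≤ (1 / 2 : ℝ) ^ (i.2.1 + 1) / Z :=
          (pow_le_pow_of_le_one (by norm_num) (by norm_num) (by have := i.2.2; omega)).trans
            (hp i.2)
        calc m / 2 ^ (J + 3) = (1 / 2 : ℝ) ^ (J + 1) * m / 4 := by
              rw [one_div, inv_pow]; field_simp; ring
          _ ≤ (1 / 2 : ℝ) ^ (J + 1) * (M i.1).card / 4 := by gcongr; exact i.1.2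
          _ ≤ _ := by gcongr
      refine (Finset.sum_le_sum fun i _ => hterm i).trans_lt ?_
      rw [Finset.sum_const, nsmul_eq_mul, Finset.card_univ, Fintype.card_prod, Fintype.card_fin,
        Real.exp_neg, ← div_eq_mul_inv, div_lt_one (Real.exp_pos _)]
      refine lt_of_le_of_lt ?_ h
      push_cast
      gcongr
      exact Fintype.card_subtype_le _)
  refine ⟨fun v => (g v).1, fun i hi j hj => ?_⟩
  have hj' : j < J + 1 := by omega
  have := hg (⟨i, hi⟩, ⟨j, hj'⟩)
  have hset : (M i).filter (fun v => (g v).1 = j) = (M i).filter (fun v => g v = ⟨j, hj'⟩) := by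
    ext v; simp [Fin.ext_iff]
  rw [hset]
  refine le_trans ?_ this
  calc ((M i).card : ℝ) / 2 ^ (j + 3) = (1 / 2 : ℝ) ^ (j + 1) * (M i).card / 4 := by
        rw [one_div, inv_pow]; field_simp; ring
    _ ≤ _ := by gcongr; exact hp ⟨j, hj'⟩

/-! ### Embedding into a rich pair of sets -/

namespace SimpleGraph

open Classical in
/-- The elements of `U` that are adjacent to every entry of the tuple `Q`. -/
noncomputable def jointNeighbors {V ι : Type*} (G : SimpleGraph V) (U : Finset V) (Q : ι → V) :
    Finset V :=
  U.filter fun y => ∀ i, G.Adj (Q i) y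

theorem mem_jointNeighbors {V ι : Type*} {G : SimpleGraph V} {U : Finset V} {Q : ι → V} {y : V} :
    y ∈ G.jointNeighbors U Q ↔ y ∈ U ∧ ∀ i, G.Adj (Q i) y := by
  classical
  simp [jointNeighbors]

/-- The level of a set of size `c` relative to the threshold `θ`: the least `j` with
`θ ≤ 2 ^ j * c`. -/
noncomputable def level (θ : ℝ) (c : ℕ) : ℕ := Nat.clog 2 ⌈θ / c⌉₊

theorem le_two_pow_level_mul (θ : ℝ) {c : ℕ} (hc : 0 < c) : θ ≤ 2 ^ level θ c * c := by
  have hc' : (0 : ℝ) < c := by exact_mod_cast hc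
  rw [← div_le_iff₀ hc']
  refine (Nat.le_ceil _).trans ?_
  exact_mod_cast Nat.le_pow_clog (by norm_num) _

theorem two_pow_level_le {θ : ℝ} {c : ℕ} (h : level θ c ≠ 0) :
    (2 : ℝ) ^ level θ c ≤ 2 * θ / c := by
  have h1 : 1 < ⌈θ / c⌉₊ := by
    by_contra hle
    exact h (Nat.clog_of_right_le_one (not_lt.1 hle) 2)
  have h2 := Nat.pow_pred_clog_lt_self (b := 2) (by norm_num) h1
  have h3 : ((2 ^ (level θ c - 1) : ℕ) : ℝ) < θ / c := Nat.lt_ceil.1 h2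
  obtain ⟨j, hj⟩ := Nat.exists_eq_succ_of_ne_zero h
  rw [hj] at h3 ⊢
  push_cast at h3
  rw [pow_succ, mul_div_assoc]
  linarith

open RandomGreedy in
/-- **Embedding into a pair of rich sets.** In `S false` and `S true`, every tuple of at most `d`
vertices from one set has a common neighbor in the other one, and tuples with far fewer than `θ`
common neighbors are rare in the sense of a high negative moment. The labels `g` split the vertices
into disjoint reservoirs, each taking its due share of every large common neighborhood. Then a
bipartite graph on `0, …, n - 1` in which every vertex has at most `d` smaller neighbors embeds.

The vertices are embedded randomly in increasing order; a vertex whose available common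
neighborhood has level `j` goes to the reservoir `j`, avoiding earlier images as long as at least
half of its candidates are unused. -/
theorem exists_embedding_of_rich {V : Type*} [Fintype V] [Nonempty V] (G : SimpleGraph V)
    (S : Bool → Finset V) {d n : ℕ} (hd : 1 ≤ d) {θ : ℝ} (hθ0 : 0 < θ) (hθ : 16 * n ≤ θ)
    (hθV : θ ≤ Fintype.card V)
    (hne : ∀ b, ∀ k, ∀ Q : Fin k → V, (∀ i, Q i ∈ S (!b)) → (G.jointNeighbors (S b) Q).Nonempty)
    (hmom : ∀ b, ∀ k ≤ d, (16 / θ) ^ k * ∑ Q ∈ Fintype.piFinset (fun _ : Fin k => S (!b)),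
      (2 * θ / (G.jointNeighbors (S b) Q).card) ^ (16 * d) ≤ 1 / (1 + 2 * d))
    (g : V → ℕ)
    (hg : ∀ b, ∀ k ≤ d, ∀ Q : Fin k → V,
      θ / 2 ^ (Nat.log (2 ^ (8 * d)) n) ≤ (G.jointNeighbors (S b) Q).card →
      ∀ j ≤ Nat.log (2 ^ (8 * d)) n, ((G.jointNeighbors (S b) Q).card : ℝ) / 2 ^ (j + 3) ≤
        ((G.jointNeighbors (S b) Q).filter (fun v => g v = j)).card)
    (back : ℕ → Finset ℕ) (hlt : ∀ w, ∀ u ∈ back w, u < w) (hcard : ∀ w, (back w).card ≤ d)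
    (χ : ℕ → Bool) (hχ : ∀ w, ∀ u ∈ back w, χ u = !χ w) :
    ∃ f : ℕ → V, (∀ w < n, ∀ u ∈ back w, G.Adj (f u) (f w)) ∧ Set.InjOn f (Set.Iio n) := by
  classical
  set J := Nat.log (2 ^ (8 * d)) n with hJ
  set k : ℕ → ℕ := fun w => (back w).card with hk
  set e : ∀ w, Fin (k w) → ℕ := fun w => (back w).orderEmbOfFin rfl with he
  have hemem : ∀ w i, e w i ∈ back w := fun w i => (back w).orderEmbOfFin_mem rfl i
  have helt : ∀ w i, e w i < w := fun w i => hlt w _ (hemem w i)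
  have hesurj : ∀ w, ∀ u ∈ back w, ∃ i, e w i = u := fun w u hu => by
    have : u ∈ Set.range ((back w).orderEmbOfFin rfl) := by
      rw [Finset.range_orderEmbOfFin]; exact hu
    exact this
  set X : ∀ w, (Fin (k w) → V) → Finset V := fun w Q => G.jointNeighbors (S (χ w)) Q with hX
  set valid : ∀ w, (Fin (k w) → V) → Prop := fun w Q => ∀ i, Q i ∈ S (!χ w) with hvalid
  set τ : ∀ w, (Fin (k w) → V) → ℕ := fun w Q => if valid w Q then level θ (X w Q).card else 0
    with hτ
  -- `F` is the candidate set before the used vertices are removed; tuples outside the host set never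
  -- occur in an outcome, and get all vertices as candidates and level `0`
  set F : ∀ w, (Fin (k w) → V) → Finset V := fun w Q => if valid w Q then
    (if τ w Q ≤ J then (X w Q).filter (fun v => g v = τ w Q) else X w Q) else Finset.univ with hF
  set used : ℕ → (ℕ → V) → Finset V := fun w f => (Finset.range w).image f with hused
  set C : ℕ → (ℕ → V) → Finset V := fun w f =>
    if (F w (f ∘ e w)).card ≤ 2 * (F w (f ∘ e w) \ used w f).card then
      F w (f ∘ e w) \ used w f else F w (f ∘ e w) with hC
  have hXpos : ∀ w Q, valid w Q → 0 < (X w Q).card := fun w Q hQ => (hne _ _ Q hQ).card_pos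
  have hτX : ∀ w Q, valid w Q → θ ≤ 2 ^ τ w Q * (X w Q).card := fun w Q hQ => by
    simp only [hτ, if_pos hQ]
    exact le_two_pow_level_mul θ (hXpos w Q hQ)
  have hFcard : ∀ w Q, θ / (8 * 4 ^ τ w Q) ≤ (F w Q).card := by
    intro w Q
    by_cases hQ : valid w Q
    · have h1 := hτX w Q hQ
      have h2 : θ / 2 ^ τ w Q ≤ (X w Q).card := by
        rw [div_le_iff₀ (by positivity)]; linarith
      have h3 : θ / (8 * 4 ^ τ w Q) ≤ ((X w Q).card : ℝ) / 2 ^ (τ w Q + 3) := by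
        have : (8 * 4 ^ τ w Q : ℝ) = 2 ^ τ w Q * 2 ^ (τ w Q + 3) := by
          rw [show (4 : ℝ) = 2 * 2 by norm_num, mul_pow]; ring
        rw [this, ← div_div]
        gcongr
      by_cases hj : τ w Q ≤ J
      · simp only [hF, if_pos hQ, if_pos hj]
        refine h3.trans (hg _ _ (hcard w) Q (le_trans ?_ h2) _ hj)
        gcongr
        norm_num
      · simp only [hF, if_pos hQ, if_neg hj]
        refine h3.trans (div_le_self (by positivity) (one_le_pow₀ (by norm_num)))
    · simp only [hF, if_neg hQ, hτ, Finset.card_univ]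
      refine le_trans ?_ hθV
      simp only [pow_zero, mul_one]
      linarith
  have hCcard : ∀ w f, (F w (f ∘ e w)).card ≤ 2 * (C w f).card := by
    intro w f
    simp only [hC]
    split_ifs with h
    · exact h
    · omega
  have hCreal : ∀ w f, θ / (16 * 4 ^ τ w (f ∘ e w)) ≤ (C w f).card := by
    intro w f
    have h1 := hFcard w (f ∘ e w)
    have h2 : ((F w (f ∘ e w)).card : ℝ) ≤ 2 * (C w f).card := by exact_mod_cast hCcard w f
    have h3 : θ / (8 * 4 ^ τ w (f ∘ e w)) = 2 * (θ / (16 * 4 ^ τ w (f ∘ e w))) := by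
      field_simp; norm_num
    linarith
  have hCne : ∀ w f, (C w f).Nonempty := by
    intro w f
    rw [← Finset.card_pos]
    have : (0 : ℝ) < (C w f).card := lt_of_lt_of_le (by positivity) (hCreal w f)
    exact_mod_cast this
  have hCd : ∀ w, DependsOn (C w) (Set.Iio w) := by
    intro w x y hxy
    have h1 : x ∘ e w = y ∘ e w := funext fun i => hxy _ (helt w i)
    have h2 : used w x = used w y := Finset.image_congr fun u hu => hxy u (by simpa using hu)
    simp only [hC, h1, h2]
  obtain ⟨f, hfC, hfw⟩ := exists_outcome n d hCne hCd k hcard e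
    (fun w => ((back w).orderEmbOfFin rfl).strictMono) helt τ (ρ := 16 / θ) (by positivity)
    (by
      intro w f
      have h1 := hCreal w f
      have h2 : (0 : ℝ) < θ / (16 * 4 ^ τ w (f ∘ e w)) := by positivity
      calc 1 / ((C w f).card : ℝ) ≤ 1 / (θ / (16 * 4 ^ τ w (f ∘ e w))) :=
            one_div_le_one_div_of_le h2 h1
        _ = 16 / θ * 4 ^ τ w (f ∘ e w) := by field_simp)
    (by
      intro w
      refine le_trans ?_ (hmom (χ w) (k w) (hcard w))
      gcongr
      rw [← Finset.sum_subset (Finset.subset_univ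
        (Fintype.piFinset (fun _ : Fin (k w) => S (!χ w))))]
      · refine Finset.sum_le_sum fun Q hQ => ?_
        have hQ' : valid w Q := fun i => Fintype.mem_piFinset.1 hQ i
        by_cases h0 : τ w Q = 0
        · rw [h0]
          simp only [weight, if_true, ne_eq, OfNat.ofNat_ne_zero, not_false_eq_true, zero_pow]
          positivity
        · have h1 : (2 : ℝ) ^ τ w Q ≤ 2 * θ / (X w Q).card := by
            simp only [hτ, if_pos hQ'] at h0 ⊢
            exact two_pow_level_le h0
          calc weight d (τ w Q) ^ 2 = ((2 : ℝ) ^ τ w Q) ^ (16 * d) := by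
                simp only [weight, if_neg h0]
                rw [← pow_mul, ← pow_mul]; ring_nf
            _ ≤ (2 * θ / (X w Q).card) ^ (16 * d) := by gcongr
      · intro Q _ hQ
        have hQ' : ¬ valid w Q := fun h => hQ (Fintype.mem_piFinset.2 h)
        simp [hτ, hQ', weight])
  -- the outcome `f` respects the classes, and only the first `J` levels occur
  have hCF : ∀ w, w < n → f w ∈ F w (f ∘ e w) := fun w hw => by
    have := hfC w hw
    simp only [hC] at this
    split_ifs at this with h
    · exact (Finset.mem_sdiff.1 this).1
    · exact this
  have hFX : ∀ w Q, valid w Q → F w Q ⊆ X w Q := fun w Q hQ => by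
    simp only [hF, if_pos hQ]
    split_ifs
    · exact Finset.filter_subset _ _
    · exact subset_rfl
  have hfS : ∀ w, w < n → f w ∈ S (χ w) := by
    intro w
    induction w using Nat.strong_induction_on with
    | _ w ih =>
    intro hw
    have hv : valid w (f ∘ e w) := fun i => by
      have := ih _ (helt w i) ((helt w i).trans hw)
      rwa [hχ w _ (hemem w i)] at this
    exact (mem_jointNeighbors.1 (hFX _ _ hv (hCF w hw))).1
  have hv : ∀ w, w < n → valid w (f ∘ e w) := fun w hw i => by
    have := hfS _ ((helt w i).trans hw)
    rwa [hχ w _ (hemem w i)] at this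
  have hcount : ∀ j, (((Finset.range n).filter fun w => τ w (f ∘ e w) = j).card : ℝ) *
      4 ^ j ≤ n := by
    intro j
    by_cases hj : j = 0
    · subst hj
      simp only [pow_zero, mul_one]
      exact_mod_cast (Finset.card_filter_le _ _).trans (by simp)
    · refine le_trans ?_ hfw
      rw [← nsmul_eq_mul, ← Finset.sum_const]
      refine le_trans (Finset.sum_le_sum fun w hw => ?_)
        (Finset.sum_le_sum_of_subset_of_nonneg (Finset.filter_subset _ _)
          fun w _ _ => weight_nonneg _ _)
      rw [(Finset.mem_filter.1 hw).2, weight, if_neg hj,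
        show (4 : ℝ) = 2 ^ 2 by norm_num, ← pow_mul]
      exact pow_le_pow_right₀ (by norm_num) (by nlinarith [Nat.zero_le j])
  have hτJ : ∀ w, w < n → τ w (f ∘ e w) ≤ J := by
    intro w hw
    by_cases h0 : τ w (f ∘ e w) = 0
    · omega
    · have h1 : weight d (τ w (f ∘ e w)) ≤ n :=
        (Finset.single_le_sum (f := fun w => weight d (τ w (f ∘ e w)))
          (fun w _ => weight_nonneg _ _) (Finset.mem_range.2 hw)).trans hfw
      rw [weight, if_neg h0, pow_mul] at h1
      exact Nat.le_log_of_pow_le (Nat.one_lt_two_pow (by omega)) (by exact_mod_cast h1)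
  have hlabel : ∀ w, w < n → g (f w) = τ w (f ∘ e w) := fun w hw => by
    have := hCF w hw
    simp only [hF, if_pos (hv w hw), if_pos (hτJ w hw)] at this
    exact (Finset.mem_filter.1 this).2
  have hnew : ∀ w, w < n → f w ∉ used w f := by
    intro w hw
    set j := τ w (f ∘ e w) with hj
    set Fw := F w (f ∘ e w) with hFw
    have hinter : Fw ∩ used w f ⊆
        ((Finset.range n).filter fun u => τ u (f ∘ e u) = j).image f := by
      intro y hy
      obtain ⟨hy1, hy2⟩ := Finset.mem_inter.1 hy
      obtain ⟨u, hu, rfl⟩ := Finset.mem_image.1 hy2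
      have hun : u < n := (Finset.mem_range.1 hu).trans hw
      refine Finset.mem_image_of_mem _ (Finset.mem_filter.2 ⟨Finset.mem_range.2 hun, ?_⟩)
      rw [← hlabel u hun]
      simp only [hFw, hF, if_pos (hv w hw), if_pos (hτJ w hw)] at hy1
      exact (Finset.mem_filter.1 hy1).2
    have h1 : ((Fw ∩ used w f).card : ℝ) ≤ n / 4 ^ j := by
      rw [le_div_iff₀ (by positivity)]
      refine le_trans ?_ (hcount j)
      gcongr
      exact (Finset.card_le_card hinter).trans Finset.card_image_le
    have h2 : 2 * (n / 4 ^ j : ℝ) ≤ Fw.card := by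
      refine le_trans ?_ (hFcard w (f ∘ e w))
      rw [← hj, ← div_div, ← mul_div_assoc]
      gcongr
      linarith
    have h3 : 2 * (Fw ∩ used w f).card ≤ Fw.card := by
      have : (2 : ℝ) * (Fw ∩ used w f).card ≤ Fw.card := by linarith
      exact_mod_cast this
    have h4 := Finset.card_sdiff_add_card_inter Fw (used w f)
    have := hfC w hw
    simp only [hC, ← hFw] at this
    rw [if_pos (by omega)] at this
    exact (Finset.mem_sdiff.1 this).2
  refine ⟨f, fun w hw u hu => ?_, ?_⟩
  · obtain ⟨i, rfl⟩ := hesurj w u hu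
    exact (mem_jointNeighbors.1 (hFX _ _ (hv w hw) (hCF w hw))).2 i
  · intro a ha b hb hab
    rcases lt_trichotomy a b with h | h | h
    · exact absurd (Finset.mem_image.2 ⟨a, Finset.mem_range.2 h, hab⟩) (hnew b hb)
    · exact h
    · exact absurd (Finset.mem_image.2 ⟨b, Finset.mem_range.2 h, hab.symm⟩) (hnew a ha)

end SimpleGraph

/-! ### Dependent random choice -/

namespace SimpleGraph

/-- If `T` is a random `s`-tuple from `X`, a tuple `Q` from `Y` lies in the common neighborhood of
`T` with probability proportional to the `s`-th power of the number of common neighbors of `Q`.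
This cancels the negative moment. -/
theorem sum_moment_jointNeighbors_le {V : Type*} (G : SimpleGraph V) (X Y : Finset V) (s : ℕ) (ι : Type*)
    [Fintype ι] [DecidableEq ι] :
    ∑ T ∈ Fintype.piFinset (fun _ : Fin s => X),
      ∑ Q ∈ Fintype.piFinset (fun _ : ι => G.jointNeighbors Y T),
        (1 / ((G.jointNeighbors X Q).card : ℝ)) ^ s ≤ (Y.card : ℝ) ^ Fintype.card ι := by
  rw [Finset.sum_comm' (s' := fun Q => Fintype.piFinset (fun _ : Fin s => G.jointNeighbors X Q))
    (t' := Fintype.piFinset (fun _ : ι => Y))]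
  · calc _ ≤ ∑ Q ∈ Fintype.piFinset (fun _ : ι => Y), (1 : ℝ) := by
          refine Finset.sum_le_sum fun Q _ => ?_
          rw [Finset.sum_const, Fintype.card_piFinset_const, nsmul_eq_mul, Nat.cast_pow, ← mul_pow]
          refine pow_le_one₀ (by positivity) ?_
          rw [mul_one_div]
          exact div_self_le_one _
      _ = _ := by simp
  · intro T Q
    simp only [Fintype.mem_piFinset, mem_jointNeighbors]
    constructor
    · rintro ⟨h1, h2⟩
      exact ⟨fun i => ⟨h1 i, fun j => ((h2 j).2 i).symm⟩, fun j => (h2 j).1⟩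
    · rintro ⟨h1, h2⟩
      exact ⟨fun i => (h1 i).1, fun j => ⟨h2 j, fun i => ((h1 i).2 j).symm⟩⟩

/-- The average number of common neighbors of an `s`-tuple of vertices, by convexity. -/
theorem le_sum_card_jointNeighbors {V : Type*} [Fintype V] [Nonempty V] {G : SimpleGraph V}
    [DecidableRel G.Adj] {a : ℝ} (ha : 0 ≤ a)
    (h : a * (Fintype.card V : ℝ) ^ 2 ≤ ∑ v, (G.degree v : ℝ)) (s : ℕ) :
    a ^ (s + 1) * (Fintype.card V : ℝ) ^ (s + 2) ≤
      ∑ T : Fin (s + 1) → V, ((G.jointNeighbors Finset.univ T).card : ℝ) := by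
  classical
  have hN : (0 : ℝ) < Fintype.card V := by exact_mod_cast Fintype.card_pos
  have h1 : ∑ T : Fin (s + 1) → V, (G.jointNeighbors Finset.univ T).card =
      ∑ v, G.degree v ^ (s + 1) := by
    simp only [Finset.card_eq_sum_ones]
    rw [Finset.sum_comm' (s' := fun v => Fintype.piFinset (fun _ : Fin (s + 1) =>
      G.neighborFinset v)) (t' := Finset.univ)]
    · simp
    · intro T v
      simp [mem_jointNeighbors, G.adj_comm]
  have h3 := pow_sum_div_card_le_sum_pow (s := (Finset.univ : Finset V))
    (f := fun v => (G.degree v : ℝ)) (fun v _ => by positivity) s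
  have h4 : (∑ T : Fin (s + 1) → V, ((G.jointNeighbors Finset.univ T).card : ℝ)) =
      ∑ v, (G.degree v : ℝ) ^ (s + 1) := by exact_mod_cast h1
  rw [h4]
  refine le_trans ?_ h3
  rw [Finset.card_univ, le_div_iff₀ (by positivity)]
  calc a ^ (s + 1) * (Fintype.card V : ℝ) ^ (s + 2) * (Fintype.card V : ℝ) ^ s
      = (a * (Fintype.card V : ℝ) ^ 2) ^ (s + 1) := by rw [mul_pow, ← pow_mul]; ring
    _ ≤ _ := by gcongr

/-- The tuples of all lengths up to `d` together, on the scale `β * N`. -/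
theorem sum_inv_pow_mul_pow_le {β N : ℝ} (hβ0 : 0 < β) (hβ1 : β ≤ 1) (hN : 0 < N) (d : ℕ) :
    ∑ k ∈ Finset.range (d + 1), (1 / (β * N)) ^ k * N ^ k ≤ (d + 1) * (1 / β) ^ d := by
  calc _ ≤ ∑ k ∈ Finset.range (d + 1), (1 / β) ^ d := by
        refine Finset.sum_le_sum fun k hk => ?_
        rw [← mul_pow, show 1 / (β * N) * N = 1 / β by field_simp]
        exact pow_le_pow_right₀ (by rw [le_div_iff₀ hβ0]; linarith)
          (Nat.lt_succ_iff.1 (Finset.mem_range.1 hk))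
    _ = _ := by simp

/-- The first random choice: for some `s`-tuple `T` the common neighborhood of `T` is large, and
the larger tuples inside it have small negative moments. -/
theorem exists_tuple_large_jointNeighbors {V : Type*} [Fintype V] [Nonempty V] (G : SimpleGraph V)
    [DecidableRel G.Adj] {a β : ℝ} (ha0 : 0 < a) (hβ0 : 0 < β) (hβ1 : β ≤ 1)
    (h : a * (Fintype.card V : ℝ) ^ 2 ≤ ∑ v, (G.degree v : ℝ)) {s : ℕ} (hs : 1 ≤ s) (d : ℕ) :
    ∃ T : Fin s → V,
      (Fintype.card V : ℝ) * a ^ s / 2 ≤ (G.jointNeighbors Finset.univ T).card ∧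
      ∑ k ∈ Finset.range (d + 1), (1 / (β * Fintype.card V)) ^ k *
        ∑ R ∈ Fintype.piFinset (fun _ : Fin k ⊕ Fin s => G.jointNeighbors Finset.univ T),
          (1 / ((G.jointNeighbors Finset.univ R).card : ℝ)) ^ s ≤
      2 * ((d + 1) * (1 / β) ^ d) / a ^ s := by
  classical
  set N : ℝ := (Fintype.card V : ℝ) with hN
  have hNpos : 0 < N := by rw [hN]; exact_mod_cast Fintype.card_pos
  set K : ℝ := (d + 1) * (1 / β) ^ d with hK
  have hKpos : 0 < K := by positivity
  have hsumK : ∑ k ∈ Finset.range (d + 1), (1 / (β * N)) ^ k * N ^ k ≤ K :=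
    sum_inv_pow_mul_pow_le hβ0 hβ1 hNpos d
  set A : (Fin s → V) → Finset V := fun T => G.jointNeighbors Finset.univ T with hA
  obtain ⟨Y, hY⟩ : ∃ Y : (Fin s → V) → ℝ, ∀ T, Y T = ∑ k ∈ Finset.range (d + 1), (1 / (β * N)) ^ k *
    ∑ R ∈ Fintype.piFinset (fun _ : Fin k ⊕ Fin s => A T),
      (1 / ((G.jointNeighbors Finset.univ R).card : ℝ)) ^ s := ⟨_, fun _ => rfl⟩
  have hcardT : ((Finset.univ : Finset (Fin s → V)).card : ℝ) = N ^ s := by simp [hN]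
  have hXsum : a ^ s * N ^ (s + 1) ≤ ∑ T, ((A T).card : ℝ) := by
    obtain ⟨t, rfl⟩ : ∃ t, s = t + 1 := ⟨s - 1, by omega⟩
    exact le_sum_card_jointNeighbors ha0.le h t
  have hYsum : ∑ T, Y T ≤ K * N ^ s := by
    simp only [hY]
    rw [Finset.sum_comm]
    simp only [← Finset.mul_sum]
    calc _ ≤ ∑ k ∈ Finset.range (d + 1), (1 / (β * N)) ^ k * N ^ (k + s) := by
          gcongr with k
          have := sum_moment_jointNeighbors_le G Finset.univ Finset.univ s (Fin k ⊕ Fin s)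
          simpa only [Fintype.piFinset_univ, Finset.card_univ, Fintype.card_sum,
            Fintype.card_fin] using this
      _ = (∑ k ∈ Finset.range (d + 1), (1 / (β * N)) ^ k * N ^ k) * N ^ s := by
          rw [Finset.sum_mul]
          exact Finset.sum_congr rfl fun k _ => by ring
      _ ≤ K * N ^ s := by gcongr
  -- a choice of `T` that is good both for the size and for the moments of `A T`
  obtain ⟨T, -, hT⟩ : ∃ T ∈ (Finset.univ : Finset (Fin s → V)),
      (1 / 2 : ℝ) ≤ (A T).card / (N * a ^ s) - Y T / (2 * K) := by
    refine Finset.exists_le_of_sum_le Finset.univ_nonempty ?_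
    rw [Finset.sum_sub_distrib, Finset.sum_const, nsmul_eq_mul,
      hcardT]
    have h1 : N ^ s ≤ (∑ T, ((A T).card : ℝ)) / (N * a ^ s) := by
      rw [le_div_iff₀ (by positivity)]
      calc N ^ s * (N * a ^ s) = a ^ s * N ^ (s + 1) := by ring
        _ ≤ _ := hXsum
    have h2 : (∑ T, Y T) / (2 * K) ≤ N ^ s / 2 := by
      rw [div_le_iff₀ (by positivity)]
      calc _ ≤ K * N ^ s := hYsum
        _ = _ := by ring
    rw [Finset.sum_div] at h1 h2
    linarith
  have hYnn : 0 ≤ Y T := by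
    rw [hY]
    exact Finset.sum_nonneg fun k _ => mul_nonneg (pow_nonneg (by positivity) k)
      (Finset.sum_nonneg fun R _ => pow_nonneg (one_div_nonneg.2 (Nat.cast_nonneg _)) s)
  have hAcard : N * a ^ s / 2 ≤ (A T).card := by
    have h1 : 0 ≤ Y T / (2 * K) := by positivity
    have h2 : (1 / 2 : ℝ) ≤ (A T).card / (N * a ^ s) := by linarith
    rw [le_div_iff₀ (by positivity)] at h2
    linarith
  refine ⟨T, hAcard, ?_⟩
  rw [← hY]
  have hYT : Y T ≤ 2 * K / a ^ s := by
    have h1 : ((A T).card : ℝ) ≤ N := by rw [hN]; exact_mod_cast Finset.card_le_univ _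
    have h2 : Y T / (2 * K) ≤ (A T).card / (N * a ^ s) := by linarith
    have h3 : ((A T).card : ℝ) / (N * a ^ s) ≤ N / (N * a ^ s) := by gcongr
    have h4 : N / (N * a ^ s) = 1 / a ^ s := by field_simp
    rw [div_le_iff₀ (by positivity)] at h2
    calc Y T ≤ (A T).card / (N * a ^ s) * (2 * K) := h2
      _ ≤ 1 / a ^ s * (2 * K) := by rw [← h4]; gcongr
      _ = _ := by ring
  exact hYT

/-- **Two-sided dependent random choice.** A graph of positive density contains sets `A` and `B`
such that tuples of at most `d` vertices from one set have common neighbors in the other, and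
few of them have few. The set `B` is the common neighborhood of a random tuple `T'` from `A`, so the
common neighbors in `B` of a tuple `Q` from `A` are the common neighbors of the longer tuple
`(Q, T')` from `A`. -/
theorem exists_rich_pair {V : Type*} [Fintype V] [Nonempty V] (G : SimpleGraph V) [DecidableRel G.Adj] {a β : ℝ}
    (ha0 : 0 < a) (ha1 : a ≤ 1) (hβ0 : 0 < β) (hβ1 : β ≤ 1)
    (h : a * (Fintype.card V : ℝ) ^ 2 ≤ ∑ v, (G.degree v : ℝ)) {s : ℕ} (hs : 1 ≤ s) (d : ℕ) :
    ∃ A B : Finset V,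
      (∀ k, ∀ Q : Fin k → V, (∀ i, Q i ∈ A) → (G.jointNeighbors B Q).Nonempty) ∧
      (∀ k, ∀ Q : Fin k → V, (∀ i, Q i ∈ B) → (G.jointNeighbors A Q).Nonempty) ∧
      ∑ k ∈ Finset.range (d + 1), (1 / (β * Fintype.card V)) ^ k *
        (∑ Q ∈ Fintype.piFinset (fun _ : Fin k => A),
          (1 / ((G.jointNeighbors B Q).card : ℝ)) ^ s +
        ∑ Q ∈ Fintype.piFinset (fun _ : Fin k => B),
          (1 / ((G.jointNeighbors A Q).card : ℝ)) ^ s) ≤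
      3 * ((d + 1) * (1 / β) ^ d) / a ^ s * (2 / (Fintype.card V * a ^ s)) ^ s := by
  classical
  set N : ℝ := (Fintype.card V : ℝ) with hN
  have hNpos : 0 < N := by rw [hN]; exact_mod_cast Fintype.card_pos
  set K : ℝ := (d + 1) * (1 / β) ^ d with hK
  have hKpos : 0 < K := by positivity
  have hsumK : ∑ k ∈ Finset.range (d + 1), (1 / (β * N)) ^ k * N ^ k ≤ K :=
    sum_inv_pow_mul_pow_le hβ0 hβ1 hNpos d
  obtain ⟨T, hAcard, hYT⟩ := exists_tuple_large_jointNeighbors G ha0 hβ0 hβ1 h hs d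
  rw [← hN] at hAcard hYT
  rw [← hK] at hYT
  set A : (Fin s → V) → Finset V := fun T => G.jointNeighbors Finset.univ T with hA
  have has : a ^ s ≤ 1 := pow_le_one₀ ha0.le ha1
  have hApos : (0 : ℝ) < (A T).card := lt_of_lt_of_le (by positivity) hAcard
  have hAne : (A T).Nonempty := Finset.card_pos.1 (by exact_mod_cast hApos)
  obtain ⟨F, hF⟩ : ∃ F : (Fin s → V) → ℝ, ∀ T', F T' = ∑ k ∈ Finset.range (d + 1), (1 / (β * N)) ^ k *
        (∑ Q ∈ Fintype.piFinset (fun _ : Fin k => A T),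
          (1 / ((G.jointNeighbors (A T') Q).card : ℝ)) ^ s +
        ∑ Q ∈ Fintype.piFinset (fun _ : Fin k => A T'),
          (1 / ((G.jointNeighbors (A T) Q).card : ℝ)) ^ s) := ⟨_, fun _ => rfl⟩
  have hFsum : ∑ T' ∈ Fintype.piFinset (fun _ : Fin s => A T), F T' ≤ 3 * K / a ^ s := by
    have e1 : ∀ k, ∑ T' ∈ Fintype.piFinset (fun _ : Fin s => A T),
        ∑ Q ∈ Fintype.piFinset (fun _ : Fin k => A T),
          (1 / ((G.jointNeighbors (A T') Q).card : ℝ)) ^ s =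
        ∑ R ∈ Fintype.piFinset (fun _ : Fin k ⊕ Fin s => A T),
          (1 / ((G.jointNeighbors Finset.univ R).card : ℝ)) ^ s := by
      intro k
      rw [Finset.sum_comm, ← Finset.sum_product']
      symm
      refine Finset.sum_equiv (Equiv.sumArrowEquivProdArrow (Fin k) (Fin s) V) ?_ ?_
      · intro R
        simp [Fintype.mem_piFinset, Equiv.sumArrowEquivProdArrow]
      · intro R _
        congr 4
        ext y
        simp [hA, mem_jointNeighbors, Equiv.sumArrowEquivProdArrow, and_comm]
    have e2 : ∀ k, ∑ T' ∈ Fintype.piFinset (fun _ : Fin s => A T),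
        ∑ Q ∈ Fintype.piFinset (fun _ : Fin k => A T'),
          (1 / ((G.jointNeighbors (A T) Q).card : ℝ)) ^ s ≤ N ^ k := by
      intro k
      have := sum_moment_jointNeighbors_le G (A T) Finset.univ s (Fin k)
      simpa only [Finset.card_univ, Fintype.card_fin] using this
    simp only [hF]
    rw [Finset.sum_comm]
    simp only [← Finset.mul_sum, Finset.sum_add_distrib, e1]
    simp only [mul_add, Finset.sum_add_distrib]
    have h1 : ∑ k ∈ Finset.range (d + 1), (1 / (β * N)) ^ k *
        ∑ T' ∈ Fintype.piFinset (fun _ : Fin s => A T),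
        ∑ Q ∈ Fintype.piFinset (fun _ : Fin k => A T'),
          (1 / ((G.jointNeighbors (A T) Q).card : ℝ)) ^ s ≤ K := by
      refine le_trans ?_ hsumK
      gcongr with k
      exact e2 k
    have h2 : K ≤ K / a ^ s := by
      rw [le_div_iff₀ (by positivity)]
      exact mul_le_of_le_one_right hKpos.le has
    calc _ ≤ 2 * K / a ^ s + K / a ^ s := add_le_add hYT (h1.trans h2)
      _ = _ := by ring
  obtain ⟨T', hT'A, hT'⟩ : ∃ T' ∈ Fintype.piFinset (fun _ : Fin s => A T),
      F T' ≤ 3 * K / a ^ s * (2 / (N * a ^ s)) ^ s := by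
    refine Finset.exists_le_of_sum_le (Fintype.piFinset_nonempty.2 fun _ => hAne) ?_
    rw [Finset.sum_const, nsmul_eq_mul, Fintype.card_piFinset_const]
    refine hFsum.trans ?_
    have h1 : 1 ≤ ((A T).card : ℝ) * (2 / (N * a ^ s)) := by
      rw [← mul_div_assoc, le_div_iff₀ (by positivity)]
      linarith
    have h2 : 1 ≤ (((A T).card : ℝ) * (2 / (N * a ^ s))) ^ s := one_le_pow₀ h1
    rw [mul_pow] at h2
    push_cast
    calc 3 * K / a ^ s = 3 * K / a ^ s * 1 := by ring
      _ ≤ 3 * K / a ^ s * (((A T).card : ℝ) ^ s * (2 / (N * a ^ s)) ^ s) := by gcongr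
      _ = _ := by ring
  rw [Fintype.mem_piFinset] at hT'A
  rw [hF] at hT'
  refine ⟨A T, A T', fun k Q hQ => ⟨T ⟨0, hs⟩, ?_⟩, fun k Q hQ => ⟨T' ⟨0, hs⟩, ?_⟩, hT'⟩
  · refine mem_jointNeighbors.2 ⟨mem_jointNeighbors.2 ⟨Finset.mem_univ _, fun i => ?_⟩, fun i => ?_⟩
    · exact ((mem_jointNeighbors.1 (hT'A i)).2 _).symm
    · exact ((mem_jointNeighbors.1 (hQ i)).2 _).symm
  · exact mem_jointNeighbors.2 ⟨hT'A _, fun i => ((mem_jointNeighbors.1 (hQ i)).2 _).symm⟩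

end SimpleGraph

/-! ### Degeneracy orders -/

namespace SimpleGraph

/-- The vertices of a degenerate graph can be ordered such that every vertex has at most `d`
neighbors before it. -/
theorem IsDegenerate.exists_equiv {n d : ℕ} {H : SimpleGraph (Fin n)} [DecidableRel H.Adj]
    (hH : H.IsDegenerate d) :
    ∃ σ : Fin n ≃ Fin n, ∀ v, (Finset.univ.filter fun u => H.Adj u v ∧ σ u < σ v).card ≤ d := by
  have key : ∀ m, ∀ s : Finset (Fin n), s.card = m → ∃ r : Fin n → ℕ, Set.InjOn r s ∧
      (∀ v ∈ s, r v < m) ∧ ∀ v ∈ s, (s.filter fun u => H.Adj u v ∧ r u < r v).card ≤ d := by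
    intro m
    induction m with
    | zero =>
      intro s hs
      obtain rfl := Finset.card_eq_zero.1 hs
      exact ⟨fun _ => 0, by simp, by simp, by simp⟩
    | succ m ih =>
      intro s hs
      have hne : s.Nonempty := Finset.card_pos.1 (by omega)
      obtain ⟨v₀, hv₀, hdeg⟩ := hH ((⊤ : H.Subgraph).induce (s : Set (Fin n))) (by simpa using hne)
      replace hv₀ : v₀ ∈ s := by simpa using hv₀
      obtain ⟨r, hinj, hr, hd⟩ := ih (s.erase v₀) (by rw [Finset.card_erase_of_mem hv₀]; omega)
      have hmem : ∀ {v}, v ∈ s → v ≠ v₀ → v ∈ s.erase v₀ := fun h1 h2 =>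
        Finset.mem_erase.2 ⟨h2, h1⟩
      refine ⟨Function.update r v₀ m, ?_, ?_, ?_⟩
      · intro u hu v hv huv
        by_cases h1 : u = v₀ <;> by_cases h2 : v = v₀
        · rw [h1, h2]
        · subst h1
          have := hr v (hmem hv h2)
          simp [h2] at huv
          omega
        · subst h2
          have := hr u (hmem hu h1)
          simp [h1] at huv
          omega
        · simp only [ne_eq, h1, not_false_eq_true, Function.update_of_ne, h2] at huv
          exact hinj (hmem hu h1) (hmem hv h2) huv
      · intro v hv
        by_cases h : v = v₀
        · simp [h]
        · simpa [h] using (hr v (hmem hv h)).trans (Nat.lt_succ_self m)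
      · intro v hv
        by_cases h : v = v₀
        · subst h
          have hsub : ((s.filter fun u => H.Adj u v ∧
              Function.update r v m u < Function.update r v m v : Finset (Fin n)) : Set (Fin n)) ⊆
              ((⊤ : H.Subgraph).induce (s : Set (Fin n))).neighborSet v := by
            intro u hu
            have hu' := Finset.mem_filter.1 (Finset.mem_coe.1 hu)
            simp only [Subgraph.mem_neighborSet, Subgraph.induce_adj, Finset.mem_coe,
              Subgraph.top_adj]
            exact ⟨hv, hu'.1, hu'.2.1.symm⟩
          have := (Set.encard_le_encard hsub).trans hdeg
          rw [Set.encard_coe_eq_coe_finsetCard] at this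
          exact_mod_cast this
        · refine (Finset.card_le_card fun u hu => ?_).trans (hd v (hmem hv h))
          obtain ⟨h1, h2, h3⟩ := Finset.mem_filter.1 hu
          by_cases hu0 : u = v₀
          · subst hu0
            have := hr v (hmem hv h)
            simp [h] at h3
            omega
          · simp only [ne_eq, hu0, not_false_eq_true, Function.update_of_ne, h] at h3
            exact Finset.mem_filter.2 ⟨hmem h1 hu0, h2, h3⟩
  obtain ⟨r, hinj, hr, hd⟩ := key n Finset.univ (by simp)
  have hbij : Function.Bijective (fun v : Fin n => (⟨r v, hr v (Finset.mem_univ _)⟩ : Fin n)) :=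
    Finite.injective_iff_bijective.1 fun u v huv =>
      hinj (by simp) (by simp) (by simpa using huv)
  refine ⟨Equiv.ofBijective _ hbij, fun v => ?_⟩
  simpa using hd v (Finset.mem_univ v)

/-- Degenerate bipartite graphs are encoded by the earlier neighbors `back w` of each `w < n` in a
degeneracy order and by a `2`-coloring `χ`. If every such encoding can be realized injectively in `G`,
then `G` contains them all. -/
theorem isContained_of_forall_back {V : Type*} (G : SimpleGraph V) {n d : ℕ}
    (hG : ∀ back : ℕ → Finset ℕ, (∀ w, ∀ u ∈ back w, u < w) → (∀ w, (back w).card ≤ d) →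
      ∀ χ : ℕ → Bool, (∀ w, ∀ u ∈ back w, χ u = !χ w) →
      ∃ f : ℕ → V, (∀ w < n, ∀ u ∈ back w, G.Adj (f u) (f w)) ∧ Set.InjOn f (Set.Iio n))
    {H : SimpleGraph (Fin n)} (hd : H.IsDegenerate d) (hb : H.IsBipartite) :
    H.IsContained G := by
  classical
  obtain ⟨σ, hσ⟩ := hd.exists_equiv
  obtain ⟨col⟩ := hb
  set back : ℕ → Finset ℕ := fun w => if h : w < n then
    (Finset.univ.filter fun u => H.Adj u (σ.symm ⟨w, h⟩) ∧ σ u < ⟨w, h⟩).image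
      (fun u => (σ u : ℕ)) else ∅ with hback
  set χ : ℕ → Bool := fun w => if h : w < n then decide (col (σ.symm ⟨w, h⟩) = 0) else true with hχ
  have hmem : ∀ {w u}, u ∈ back w → ∃ (h : w < n) (x : Fin n), H.Adj x (σ.symm ⟨w, h⟩) ∧
      σ x < ⟨w, h⟩ ∧ (σ x : ℕ) = u := by
    intro w u hu
    by_cases h : w < n
    · simp only [hback, dif_pos h, Finset.mem_image, Finset.mem_filter, Finset.mem_univ,
        true_and] at hu
      obtain ⟨x, ⟨h1, h2⟩, h3⟩ := hu
      exact ⟨h, x, h1, h2, h3⟩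
    · simp [hback, h] at hu
  have hback_lt : ∀ w, ∀ u ∈ back w, u < w := by
    intro w u hu
    obtain ⟨h, x, -, h2, rfl⟩ := hmem hu
    exact h2
  have hback_card : ∀ w, (back w).card ≤ d := by
    intro w
    by_cases h : w < n
    · simp only [hback, dif_pos h]
      refine Finset.card_image_le.trans ?_
      have := hσ (σ.symm ⟨w, h⟩)
      simpa using this
    · simp [hback, h]
  have hback_col : ∀ w, ∀ u ∈ back w, χ u = !χ w := by
    intro w u hu
    obtain ⟨h, x, h1, h2, rfl⟩ := hmem hu
    have hne := col.valid h1
    simp only [hχ, dif_pos h, dif_pos (σ x).2, Fin.eta, Equiv.symm_apply_apply]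
    generalize col x = i at *
    generalize col (σ.symm ⟨w, h⟩) = j at *
    fin_cases i <;> fin_cases j <;> simp_all
  obtain ⟨f, hadj, hinj⟩ := hG back hback_lt hback_card χ hback_col
  have hlt : ∀ x y, H.Adj x y → σ x < σ y → G.Adj (f (σ x)) (f (σ y)) := by
    intro x y hxy hlt
    refine hadj _ (σ y).2 _ ?_
    simp only [hback, dif_pos (σ y).2, Fin.eta, Equiv.symm_apply_apply]
    exact Finset.mem_image_of_mem _ (Finset.mem_filter.2 ⟨Finset.mem_univ _, hxy, hlt⟩)
  refine ⟨Hom.toCopy ⟨fun x => f (σ x), fun {x y} hxy => ?_⟩ fun x y hxy => ?_⟩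
  · rcases lt_trichotomy (σ x) (σ y) with h | h | h
    · exact hlt x y hxy h
    · exact absurd (σ.injective h) hxy.ne
    · exact (hlt y x hxy.symm h).symm
  · exact σ.injective (Fin.ext (hinj (σ x).2 (σ y).2 hxy))

/-! ### The choice of the parameters -/

/-- A graph of density at least `α ≤ 1 / 2` has at least two vertices and average degree at least
`α ^ 2 * #V`. -/
theorem le_sum_degree_of_le_density {V : Type*} [Fintype V] (G : SimpleGraph V)
    [DecidableRel G.Adj] {α : ℝ} (hα0 : 0 < α) (hα1 : α ≤ 1 / 2) (h : α ≤ G.density) :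
    2 ≤ Fintype.card V ∧ α ^ 2 * (Fintype.card V : ℝ) ^ 2 ≤ ∑ v, (G.degree v : ℝ) := by
  classical
  have hN : 2 ≤ Fintype.card V := by
    by_contra hlt
    have : (Nat.card V).choose 2 = 0 := Nat.choose_eq_zero_of_lt (by
      rw [Nat.card_eq_fintype_card]; omega)
    rw [density, this, Nat.cast_zero, div_zero] at h
    linarith
  refine ⟨hN, ?_⟩
  have hE : (∑ v, (G.degree v : ℝ)) = 2 * (G.edgeSet.ncard : ℝ) := by
    have h1 := G.sum_degrees_eq_twice_card_edges
    rw [← coe_edgeFinset, Set.ncard_coe_finset]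
    exact_mod_cast h1
  have hN' : (2 : ℝ) ≤ Fintype.card V := by exact_mod_cast hN
  rw [density, Nat.card_eq_fintype_card, Nat.cast_choose_two,
    le_div_iff₀ (by nlinarith)] at h
  rw [hE]
  have h2 : α ^ 2 * (Fintype.card V : ℝ) ^ 2 ≤ α * (1 / 2) * (Fintype.card V : ℝ) ^ 2 := by
    rw [sq α]; gcongr
  have h3 : 0 ≤ α * (Fintype.card V : ℝ) * ((Fintype.card V : ℝ) - 2) := by
    have : 0 ≤ (Fintype.card V : ℝ) - 2 := by linarith
    positivity
  nlinarith

theorem succ_le_two_pow (d : ℕ) : (d : ℝ) + 1 ≤ 2 ^ d := by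
  exact_mod_cast Nat.lt_two_pow_self (n := d)

/-- The parameters of the two-sided dependent random choice with `a = q⁻¹ ^ 2`, `β = q⁻¹ ^ (96 d)`
and moment `s = 16 d` beat the loss in the random greedy embedding. -/
theorem moment_bound_numeric {q : ℝ} (hq : 2 ≤ q) {d : ℕ} (hd : 1 ≤ d) :
    16 ^ d * 3 * ((d + 1) * (q ^ (96 * d)) ^ d) * (q ^ 2) ^ (16 * d) *
      (4 * (q ^ 2) ^ (16 * d) / q ^ (96 * d)) ^ (16 * d) ≤ 1 / (1 + 2 * (d : ℝ)) := by
  have hq0 : 0 < q := by linarith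
  have e1 : (4 * (q ^ 2) ^ (16 * d) / q ^ (96 * d) : ℝ) = 4 / q ^ (64 * d) := by
    rw [div_eq_div_iff (by positivity) (by positivity)]
    ring
  have h1 : 16 ^ d * 3 * ((d + 1 : ℝ)) * 4 ^ (16 * d) * (1 + 2 * d) ≤ q ^ (41 * d) := by
    have h3 := succ_le_two_pow d
    have h4 : (1 + 2 * d : ℝ) ≤ 2 ^ (2 * d) := by
      calc (1 + 2 * d : ℝ) ≤ (d + 1) * (d + 1) := by nlinarith [sq_nonneg (d : ℝ)]
        _ ≤ 2 ^ d * 2 ^ d := by gcongr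
        _ = _ := by ring
    have h5 : (3 : ℝ) ≤ 2 ^ (2 * d) := by
      calc (3 : ℝ) ≤ 2 ^ (2 * 1) := by norm_num
        _ ≤ _ := pow_le_pow_right₀ (by norm_num) (by omega)
    calc 16 ^ d * 3 * ((d + 1 : ℝ)) * 4 ^ (16 * d) * (1 + 2 * d)
        ≤ 16 ^ d * 2 ^ (2 * d) * 2 ^ d * 4 ^ (16 * d) * 2 ^ (2 * d) := by gcongr
      _ = 2 ^ (41 * d) := by
        rw [show (16 : ℝ) = 2 ^ 4 by norm_num, show (4 : ℝ) = 2 ^ 2 by norm_num]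
        simp only [← pow_mul, ← pow_add]
        ring_nf
      _ ≤ q ^ (41 * d) := by gcongr
  rw [e1, le_div_iff₀ (by positivity), div_pow]
  calc _ = (16 ^ d * 3 * ((d + 1 : ℝ)) * 4 ^ (16 * d) * (1 + 2 * d)) *
        (((q ^ (96 * d)) ^ d) * (q ^ 2) ^ (16 * d)) / (q ^ (64 * d)) ^ (16 * d) := by ring
    _ ≤ q ^ (41 * d) * (((q ^ (96 * d)) ^ d) * (q ^ 2) ^ (16 * d)) /
        (q ^ (64 * d)) ^ (16 * d) := by gcongr
    _ ≤ 1 := by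
      rw [div_le_one (by positivity)]
      simp only [← pow_mul, ← pow_add]
      refine pow_le_pow_right₀ (by linarith) ?_
      nlinarith

/-- Rescaling of the moment bound of the two-sided dependent random choice. -/
theorem rescaled_moment_le {q : ℝ} (hq : 2 ≤ q) {d k : ℕ} (hd : 1 ≤ d) {N M : ℝ} (hN : 0 < N)
    (hk : k ≤ d)
    (hM : (1 / (N / q ^ (96 * d))) ^ k * M ≤
      3 * ((d + 1) * (1 / q⁻¹ ^ (96 * d)) ^ d) / (q⁻¹ ^ 2) ^ (16 * d) *
        (2 / (N * (q⁻¹ ^ 2) ^ (16 * d))) ^ (16 * d)) :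
    (16 / (N / q ^ (96 * d))) ^ k * ((2 * (N / q ^ (96 * d))) ^ (16 * d) * M) ≤
      1 / (1 + 2 * (d : ℝ)) := by
  have hq0 : 0 < q := by linarith
  refine le_trans ?_ (moment_bound_numeric hq hd)
  have e1 : 1 / q⁻¹ ^ (96 * d) = q ^ (96 * d) := by simp
  have e2 : (q⁻¹ ^ 2) ^ (16 * d) = 1 / (q ^ 2) ^ (16 * d) := by simp
  rw [e1, e2] at hM
  have hU : 0 < q ^ (96 * d) := pow_pos hq0 _
  have hW : 0 < (q ^ 2) ^ (16 * d) := pow_pos (pow_pos hq0 _) _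
  generalize q ^ (96 * d) = U at *
  generalize (q ^ 2) ^ (16 * d) = W at *
  have hUd : 0 < U ^ d := pow_pos hU d
  generalize U ^ d = Y at *
  generalize 16 * d = s at *
  have hθ : 0 < N / U := div_pos hN hU
  have e3 : 4 * W / U = (2 * (N / U)) * (2 / (N * (1 / W))) := by field_simp; norm_num
  have e4 : 3 * (((d : ℝ) + 1) * Y) / (1 / W) = 3 * ((d + 1) * Y) * W := by field_simp
  rw [e4] at hM
  rw [e3, mul_pow (2 * (N / U))]
  calc (16 / (N / U)) ^ k * ((2 * (N / U)) ^ s * M)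
      = 16 ^ k * (2 * (N / U)) ^ s * ((1 / (N / U)) ^ k * M) := by
        rw [show 16 / (N / U) = 16 * (1 / (N / U)) by ring, mul_pow 16]; ring
    _ ≤ 16 ^ d * (2 * (N / U)) ^ s * (3 * ((d + 1) * Y) * W * (2 / (N * (1 / W))) ^ s) := by
        have h16 : (16 : ℝ) ^ k ≤ 16 ^ d := pow_le_pow_right₀ (by norm_num) hk
        have : 0 ≤ (2 * (N / U)) ^ s := pow_nonneg (by linarith) _
        have h3 : 0 ≤ 3 * ((d + 1) * Y) * W * (2 / (N * (1 / W))) ^ s := by positivity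
        exact (mul_le_mul_of_nonneg_left hM (by positivity)).trans
          (mul_le_mul_of_nonneg_right (mul_le_mul_of_nonneg_right h16 this) h3)
    _ = _ := by ring

/-- There are few tuples in comparison with the failure probability of a random labelling. -/
theorem labelling_bound_numeric {q : ℝ} (hq : 2 ≤ q) {d : ℕ} (hd : 1 ≤ d) {N : ℝ} {n : ℕ}
    (hnN : (n : ℝ) ≤ N) (hN : q ^ (1000 * d ^ 2) ≤ N) :
    2 * ((d + 1) * N ^ d) * ((Nat.log (2 ^ (8 * d)) n : ℝ) + 1) <
      Real.exp (N / q ^ (96 * d) / 2 ^ (Nat.log (2 ^ (8 * d)) n) /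
        2 ^ (Nat.log (2 ^ (8 * d)) n + 3)) := by
  set J := Nat.log (2 ^ (8 * d)) n with hJ
  have hq0 : 0 < q := by linarith
  have hNpos : 0 < N := lt_of_lt_of_le (by positivity) hN
  -- with `y = N ^ (1 / 8)`, each of the factors is at most a power of `y`, while the exponent on the
  -- right is at least `y ^ 5 / 8`
  obtain ⟨y, hy0, hy⟩ : ∃ y : ℝ, 0 < y ∧ y ^ 8 = N :=
    ⟨N ^ ((1 : ℝ) / 8), by positivity, by
      rw [← Real.rpow_natCast, ← Real.rpow_mul hNpos.le]; norm_num⟩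
  have hqy : q ^ (96 * d) ≤ y := by
    refine le_of_pow_le_pow_left₀ (n := 8) (by norm_num) hy0.le ?_
    rw [hy, ← pow_mul]
    refine le_trans (pow_le_pow_right₀ (by linarith) ?_) hN
    nlinarith
  have h2y : (2 : ℝ) ^ (96 * d) ≤ y := le_trans (by gcongr) hqy
  have h128 : (128 : ℝ) ≤ y := by
    refine le_trans ?_ h2y
    calc (128 : ℝ) = 2 ^ 7 := by norm_num
      _ ≤ _ := pow_le_pow_right₀ (by norm_num) (by omega)
  have hdy : 2 * ((d : ℝ) + 1) ≤ y := by
    refine le_trans ?_ h2y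
    calc 2 * ((d : ℝ) + 1) ≤ 2 * 2 ^ d := by gcongr; exact succ_le_two_pow d
      _ = 2 ^ (d + 1) := by ring
      _ ≤ _ := pow_le_pow_right₀ (by norm_num) (by omega)
  have hJy : (4 : ℝ) ^ J ≤ y ^ 2 := by
    rcases Nat.eq_zero_or_pos n with rfl | hn
    · simp only [hJ, Nat.log_zero_right, pow_zero]
      exact one_le_pow₀ (by linarith)
    · refine le_of_pow_le_pow_left₀ (n := 4) (by norm_num) (by positivity) ?_
      have h1 : (2 ^ (8 * d)) ^ J ≤ n := Nat.pow_log_le_self _ hn.ne'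
      have h2 : (((2 ^ (8 * d)) ^ J : ℕ) : ℝ) ≤ N := le_trans (by exact_mod_cast h1) hnN
      rw [← pow_mul y, hy]
      refine le_trans ?_ h2
      push_cast
      rw [show (4 : ℝ) = 2 ^ 2 by norm_num, ← pow_mul, ← pow_mul, ← pow_mul]
      refine pow_le_pow_right₀ (by norm_num) ?_
      nlinarith [Nat.zero_le J]
  have hJ1 : (J : ℝ) + 1 ≤ y ^ 2 := by
    refine le_trans ((succ_le_two_pow J).trans ?_) hJy
    gcongr
    norm_num
  have hexp : y ^ 5 / 8 ≤ N / q ^ (96 * d) / 2 ^ J / 2 ^ (J + 3) := by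
    have : (2 : ℝ) ^ J * 2 ^ (J + 3) = 8 * 4 ^ J := by
      rw [show (4 : ℝ) = 2 * 2 by norm_num, mul_pow]; ring
    rw [div_div, div_div, this, ← hy]
    calc y ^ 5 / 8 = y ^ 8 / (y * (8 * y ^ 2)) := by field_simp
      _ ≤ _ := by gcongr
  refine lt_of_lt_of_le ?_ (Real.exp_le_exp.2 hexp)
  calc 2 * ((d + 1) * N ^ d) * ((J : ℝ) + 1) = (2 * (d + 1)) * (y ^ 8) ^ d * (J + 1) := by
        rw [hy]; ring
    _ ≤ y * (y ^ 8) ^ d * y ^ 2 := by gcongr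
    _ = y ^ (8 * d + 3) := by rw [← pow_mul]; ring
    _ ≤ y ^ (11 * d) := pow_le_pow_right₀ (by linarith) (by omega)
    _ ≤ Real.exp y ^ (11 * d) := by
        gcongr
        have := Real.add_one_le_exp y; linarith
    _ = Real.exp (11 * d * y) := by rw [← Real.exp_nat_mul]; push_cast; rfl
    _ < Real.exp (y ^ 5 / 8) := by
        apply Real.exp_lt_exp.2
        have h1 : 11 * (d : ℝ) * y < 16 * y * y := by
          have : 11 * (d : ℝ) < 16 * y := by linarith
          gcongr
        have h2 : (128 : ℝ) * 1 ≤ y * y ^ 2 := by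
          gcongr; exact one_le_pow₀ (by linarith)
        have h3 : y ^ 2 * 128 ≤ y ^ 2 * (y * y ^ 2) := by gcongr; linarith
        have h4 : y ^ 2 * (y * y ^ 2) = y ^ 5 := by ring
        nlinarith

/-- The case `d ≥ 1` with explicit constants; here `q` is the inverse of the density. -/
theorem isUniversal_of_density {V : Type*} [Fintype V] (G : SimpleGraph V) {q : ℝ} (hq : 2 ≤ q)
    {d n : ℕ} (hd : 1 ≤ d) (hn : q ^ (1000 * d ^ 2) ≤ n)
    (hV : q ^ (1000 * d) * n ≤ Fintype.card V) (hG : q⁻¹ ≤ G.density) :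
    G.IsUniversalForDegenerateBipartite d n := by
  classical
  have hq0 : 0 < q := by linarith
  obtain ⟨hN2, hdeg⟩ := G.le_sum_degree_of_le_density (inv_pos.2 hq0)
    (by rw [one_div]; exact inv_anti₀ (by norm_num) hq) hG
  have : Nonempty V := Fintype.card_pos_iff.1 (by omega)
  set N : ℝ := (Fintype.card V : ℝ) with hN
  have hNpos : 0 < N := by rw [hN]; exact_mod_cast Fintype.card_pos
  have hN1 : 1 ≤ N := by rw [hN]; exact_mod_cast (by omega : 1 ≤ Fintype.card V)
  have hq1 : ∀ m, 1 ≤ q ^ m := fun m => one_le_pow₀ (by linarith)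
  have hnN : (n : ℝ) ≤ N := le_trans (le_mul_of_one_le_left (by positivity) (hq1 _)) hV
  obtain ⟨A, B, hAB, hBA, hsum⟩ := G.exists_rich_pair (a := q⁻¹ ^ 2) (β := q⁻¹ ^ (96 * d))
    (by positivity) (pow_le_one₀ (by positivity) (inv_le_one_of_one_le₀ (by linarith)))
    (by positivity) (pow_le_one₀ (by positivity) (inv_le_one_of_one_le₀ (by linarith)))
    hdeg (s := 16 * d) (by omega) d
  rw [← hN] at hsum
  set θ : ℝ := N / q ^ (96 * d) with hθ
  have hθpos : 0 < θ := by positivity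
  have hθ' : q⁻¹ ^ (96 * d) * N = θ := by rw [hθ, inv_pow]; field_simp
  rw [hθ'] at hsum
  set S : Bool → Finset V := fun b => bif b then A else B with hS
  have hpos : ∀ (X Y : Finset V) (k : ℕ), 0 ≤ ∑ Q ∈ Fintype.piFinset (fun _ : Fin k => X),
      (1 / ((G.jointNeighbors Y Q).card : ℝ)) ^ (16 * d) := fun X Y k =>
    Finset.sum_nonneg fun Q _ => pow_nonneg (one_div_nonneg.2 (Nat.cast_nonneg _)) _
  have hmom : ∀ b, ∀ k ≤ d, (16 / θ) ^ k * ∑ Q ∈ Fintype.piFinset (fun _ : Fin k => S (!b)),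
      (2 * θ / (G.jointNeighbors (S b) Q).card) ^ (16 * d) ≤ 1 / (1 + 2 * (d : ℝ)) := by
    intro b k hk
    have hterm := (Finset.single_le_sum (f := fun k => (1 / θ) ^ k * (_ + _))
      (fun k _ => mul_nonneg (pow_nonneg (one_div_nonneg.2 hθpos.le) k)
        (add_nonneg (hpos A B k) (hpos B A k)))
      (Finset.mem_range.2 (Nat.lt_succ_of_le hk))).trans hsum
    have h1 : (1 / θ) ^ k * ∑ Q ∈ Fintype.piFinset (fun _ : Fin k => S (!b)),
        (1 / ((G.jointNeighbors (S b) Q).card : ℝ)) ^ (16 * d) ≤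
        3 * ((d + 1) * (1 / q⁻¹ ^ (96 * d)) ^ d) / (q⁻¹ ^ 2) ^ (16 * d) *
          (2 / (N * (q⁻¹ ^ 2) ^ (16 * d))) ^ (16 * d) := by
      refine le_trans (mul_le_mul_of_nonneg_left ?_ (pow_nonneg (one_div_nonneg.2 hθpos.le) k))
        hterm
      cases b
      · exact le_add_of_nonneg_right (hpos B A k)
      · exact le_add_of_nonneg_left (hpos A B k)
    have h2 : ∀ Q : Fin k → V, (2 * θ / (G.jointNeighbors (S b) Q).card) ^ (16 * d) =
        (2 * θ) ^ (16 * d) * (1 / ((G.jointNeighbors (S b) Q).card : ℝ)) ^ (16 * d) :=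
      fun Q => by rw [← mul_pow, mul_one_div]
    simp only [h2]
    rw [← Finset.mul_sum]
    exact rescaled_moment_le hq hd hNpos hk h1
  have h16 : 16 * (n : ℝ) ≤ θ := by
    rw [hθ, le_div_iff₀ (by positivity)]
    refine le_trans ?_ hV
    have h1 : (16 : ℝ) * q ^ (96 * d) ≤ q ^ (1000 * d) := by
      calc (16 : ℝ) * q ^ (96 * d) ≤ q ^ 4 * q ^ (96 * d) := by
            gcongr
            calc (16 : ℝ) = 2 ^ 4 := by norm_num
              _ ≤ q ^ 4 := by gcongr
        _ = q ^ (4 + 96 * d) := by ring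
        _ ≤ _ := pow_le_pow_right₀ (by linarith) (by omega)
    nlinarith
  obtain ⟨g, hg⟩ := exists_geometric_labelling
    (ι := Bool × (Σ k : Fin (d + 1), (Fin k → V)))
    (fun i => G.jointNeighbors (S i.1) i.2.2) (Nat.log (2 ^ (8 * d)) n)
    (θ / 2 ^ (Nat.log (2 ^ (8 * d)) n)) (by
      refine lt_of_le_of_lt ?_ (labelling_bound_numeric hq hd hnN (hn.trans hnN))
      gcongr
      rw [Fintype.card_prod, Fintype.card_bool, Fintype.card_sigma]
      push_cast
      gcongr
      calc ∑ k : Fin (d + 1), ((Fintype.card (Fin k → V) : ℕ) : ℝ)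
          ≤ ∑ _k : Fin (d + 1), N ^ d := by
            refine Finset.sum_le_sum fun k _ => ?_
            rw [Fintype.card_fun, Fintype.card_fin, Nat.cast_pow]
            exact pow_le_pow_right₀ hN1 (Nat.lt_succ_iff.1 k.2)
        _ = (d + 1) * N ^ d := by simp)
  intro H hHd hHb
  refine isContained_of_forall_back G (fun back hlt hcard χ hχ =>
    exists_embedding_of_rich G S hd hθpos h16 ?_ ?_ hmom g ?_ back hlt hcard χ hχ) hHd hHb
  · exact div_le_self hNpos.le (hq1 _)
  · intro b k Q hQ
    cases b
    · exact hAB k Q hQ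
    · exact hBA k Q hQ
  · intro b k hk Q hQ j hj
    exact hg (b, ⟨⟨k, Nat.lt_succ_of_le hk⟩, Q⟩) hQ j hj

end SimpleGraph

theorem theorem1p2 :
    ∃ c : ℝ, 0 < c ∧
      ∀ (d : ℕ) (α : ℝ), 0 < α → α ≤ 1 / 2 →
        ∀ n : ℕ, α ^ (-(c * (d : ℝ) ^ 2)) ≤ (n : ℝ) →
          ∀ (V : Type*) [Finite V] (G : SimpleGraph V),
            α ^ (-(c * (d : ℝ))) * (n : ℝ) ≤ (Nat.card V : ℝ) →
            α ≤ G.density →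
            G.IsUniversalForDegenerateBipartite d n := by
  classical
  refine ⟨1000, by norm_num, fun d α hα0 hα1 n hn V _ G hV hG => ?_⟩
  have : Fintype V := Fintype.ofFinite V
  rw [Nat.card_eq_fintype_card] at hV
  rcases Nat.eq_zero_or_pos d with rfl | hd
  · -- a `0`-degenerate graph has no edges, and `G` has at least `n` vertices
    intro H hH _
    simp only [Nat.cast_zero, mul_zero, neg_zero, Real.rpow_zero, one_mul, Nat.cast_le] at hV
    obtain ⟨f⟩ : Nonempty (Fin n ↪ V) := Function.Embedding.nonempty_of_card_le (by simpa using hV)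
    obtain ⟨σ, hσ⟩ := hH.exists_equiv
    have hno : ∀ x y, σ x < σ y → ¬ H.Adj x y := fun x y h hxy => by
      have h1 := hσ y
      have h2 : x ∈ Finset.univ.filter fun u => H.Adj u y ∧ σ u < σ y := by simp [hxy, h]
      exact absurd (Finset.card_pos.2 ⟨x, h2⟩) (by omega)
    refine ⟨SimpleGraph.Hom.toCopy ⟨f, fun {x y} hxy => ?_⟩ f.injective⟩
    rcases lt_trichotomy (σ x) (σ y) with h | h | h
    · exact absurd hxy (hno x y h)
    · exact absurd (σ.injective h) hxy.ne
    · exact absurd hxy.symm (hno y x h)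
  · have hpow : ∀ m : ℕ, α ^ (-(m : ℝ)) = α⁻¹ ^ m := fun m => by
      rw [Real.rpow_neg hα0.le, Real.rpow_natCast, inv_pow]
    have e1 : (1000 * (d : ℝ) ^ 2) = ((1000 * d ^ 2 : ℕ) : ℝ) := by push_cast; rfl
    have e2 : (1000 * (d : ℝ)) = ((1000 * d : ℕ) : ℝ) := by push_cast; rfl
    rw [e1, hpow] at hn
    rw [e2, hpow] at hV
    refine G.isUniversal_of_density (q := α⁻¹) ?_ hd hn hV (by rwa [inv_inv])
    rw [le_inv_comm₀ (by norm_num) hα0]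
    linarith
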